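/- **Setting.** Let $(E,\mathcal B)$ be a measurable space and let $\nu=\nu_0,\nu_1,\nu_2,\dots$ be probability measures on it, carried by pairwise disjoint sets $E_n\in\mathcal B$, i.e. $\nu_n(E\setminus E_n)=0$ for $n\ge 0$. Assume that $\nu$ has a countable base (there is a countable family of measurable sets that is dense in $\mathcal B$ for the distance $\nu(A\triangle B)$). Let $\alpha_n>0$, $\sum_{n\ge0}\alpha_n=1$, $\mathbb M=\sum_{n\ge 0}\alpha_n\nu_n$; functions on $E$ are identified if they are equal $\mathbb M$-a.e. All $L^2$-spaces are real, $\langle\cdot,\cdot\rangle_n$ is the inner product of $L^2(E,\nu_n)$ and $\langle\cdot,\cdot\rangle=\langle\cdot,\cdot\rangle_0$. Put $\mathcal D=\{\varphi\in\bigcap_{n\ge0}L^2(E,\nu_n):\langle\varphi,\varphi\rangle_n\to\langle\varphi,\varphi\rangle\}$, let $\mathcal F\subseteq\mathcal D$ be a linear space that is dense in $L^2(E,\nu)$, and let $\mathcal C$ be the set of all $\varphi\in\mathcal D$ such that * (c1) for every $n\ge1$ there is $\varphi_n\in\mathcal F$ with $\varphi=\varphi_n$ $\nu_n$-a.e.;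 * (c2) $\langle\varphi,\psi\rangle_n\to\langle\varphi,\psi\rangle$ for all $\psi\in\mathcal F$. An element of $L^2(E,\nu_n)$ is said to be in $\mathcal C$ if it coincides $\nu_n$-a.e. with an element of $\mathcal C$. A sequence $\varphi_n\in\mathcal C$, $n\ge 1$, *w-converges* to $\varphi\in L^2(E,\nu)$ if $\langle\varphi_n,\psi\rangle_n\to\langle\varphi,\psi\rangle$ for all $\psi\in\mathcal C$; it *s-converges* to $\varphi$ if moreover $\langle\varphi_n,\varphi_n\rangle_n\to\langle\varphi,\varphi\rangle$. For subsequences $\varphi_{n_k}$ ($1\le n_1<n_2<\cdots$), the index $n$ is replaced by $n_k$. For $n\ge1$ let $(T_{n,t})_{t\ge0}$ be a strongly continuous contraction semigroup on $L^2(E,\nu_n)$ with generator $A_n$, resolvents $G_{n,\beta}=\int_0^\infty e^{-\beta t}T_{n,t}\,dt$ ($\beta>0$) and form $S_n(u,v)=-\langle A_nu,v\rangle_n$ for $u\in D(S_n)=D(A_n)$, $v\in L^2(E,\nu_n)$; put $S_{n,\beta}(u,v)=\beta\langle u,v\rangle_n+S_n(u,v)$. Let $(T_t)$, $A$, $G_\beta$,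 $S$, $S_\beta$ be the corresponding objects on $L^2(E,\nu)$. $G'_{n,\beta}$ and $G'_\beta$ denote the resolvents of the dual (adjoint) semigroups. * (c3) For all $g\in\mathcal C$, $\beta>0$ and $n\ge1$: $G_\beta g$, $G_{n,\beta}g$, $G'_\beta g$, $G'_{n,\beta}g$ are in $\mathcal C$. The forms $S_n$ *converge* to $S$ if (i)–(iii) hold: * (i) If a subsequence $\varphi_{n_k}\in D(S_{n_k})\cap\mathcal C$ w-converges to $\varphi\in L^2(E,\nu)$ and $\sup_k\langle A_{n_k}\varphi_{n_k},A_{n_k}\varphi_{n_k}\rangle_{n_k}<\infty$, then $\varphi\in D(S)$ and $S(\varphi,\varphi)\le\liminf_kS_{n_k}(\varphi_{n_k},\varphi_{n_k})$. * (ii) For every $\psi\in D(S)$ there are $\psi_n\in D(S_n)\cap\mathcal C$, $n\ge1$, s-converging to $\psi$, with $\sup_n\langle A_n\psi_n,A_n\psi_n\rangle_n<\infty$ and $\limsup_nS_n(\psi_n,\psi_n)\le S(\psi,\psi)$. * (iii) Let $\beta>0$, let $u_n\in D(S_n)\cap\mathcal C$ with $A_nu_n\in\mathcal C$ be w-convergent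 to some limit with $\sup_n\langle A_nu_n,A_nu_n\rangle_n<\infty$, and let $u\in D(S)$. If $S_{n,\beta}(u_n,\psi_n)\to S_\beta(u,\psi)$ for all $\psi\in\mathcal C$ and all $\psi_n\in\mathcal C$ s-converging to $\psi$, then $S_{n,\beta}(\psi_n,u_n)\to S_\beta(\psi,u)$ for all $\psi\in D(S)$ and all $\psi_n\in D(S_n)\cap\mathcal C$ that s-converge to $\psi$ with the two additional properties in (ii). The same is required along every subsequence $n_k$ of the indices (with $u_{n_k}$, $\psi_{n_k}$ in place of $u_n$, $\psi_n$). **Theorem 2.7.** Assume (c3), let $\beta>0$, and suppose that the forms $S_n$ converge to $S$. (a) For all $f\in L^2(E,\nu)$ and all $f_n\in\mathcal C$, $n\ge1$, w-converging to $f$: $G_{n,\beta}f_n$ w-converges to $G_\beta f$ and $G'_{n,\beta}f_n$ w-converges to $G'_\beta f$. (b) For all $g\in L^2(E,\nu)$ and all $g_n\in\mathcal C$, $n\ge1$, s-converging to $g$: $G_{n,\beta}g_n$ s-converges to $G_\beta g$ and $G'_{n,\beta}g_n$ s-converges to $G'_\beta g$. -/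

import Mathlib

open MeasureTheory Filter Topology
open scoped NNReal ENNReal

noncomputable section

/-! ## Strongly continuous contraction semigroups on a real Hilbert space -/

/-- A strongly continuous semigroup `(T_t)_{t ≥ 0}` of linear contractions on `H`. -/
structure ContractionSemigroup (H : Type*) [NormedAddCommGroup H] [InnerProductSpace ℝ H] where
  /-- the operators `T_t`, `t ≥ 0` -/
  op : ℝ≥0 → H →L[ℝ] H
  op_zero : op 0 = ContinuousLinearMap.id ℝ H
  op_add : ∀ s t, op (s + t) = (op s).comp (op t)
  norm_op_le : ∀ t, ‖op t‖ ≤ 1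
  tendsto_op : ∀ x, Tendsto (fun t => op t x) (𝓝 0) (𝓝 x)

namespace ContractionSemigroup

variable {H : Type*} [NormedAddCommGroup H] [InnerProductSpace ℝ H]

/-- The domain `D(A)` of the generator: all `u` for which `(T_t u - u) / t` converges in norm
as `t ↓ 0`. It is also the domain `D(S)` of the associated bilinear form. -/
def domain (T : ContractionSemigroup H) : Set H :=
  {u | ∃ v, Tendsto (fun t : ℝ≥0 => t⁻¹ • (T.op t u - u)) (𝓝[>] 0) (𝓝 v)}

/-- The generator `A u = lim_{t ↓ 0} (T_t u - u) / t` (meaningful for `u ∈ D(A)` only). -/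
def generator (T : ContractionSemigroup H) (u : H) : H :=
  limUnder (𝓝[>] 0) fun t : ℝ≥0 => t⁻¹ • (T.op t u - u)

/-- The bilinear form `S(u, v) = -⟨A u, v⟩ = lim_{t ↓ 0} ⟨(u - T_t u) / t, v⟩`, for `u ∈ D(S)`
and arbitrary `v ∈ H`. -/
def form (T : ContractionSemigroup H) (u v : H) : ℝ :=
  -inner ℝ (T.generator u) v

/-- The form `S_β(u, v) = β ⟨u, v⟩ + S(u, v)`, for `u ∈ D(S)` and arbitrary `v ∈ H`. -/
def formShift (T : ContractionSemigroup H) (β : ℝ) (u v : H) : ℝ :=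
  β * inner ℝ u v + T.form u v

/-- The resolvent `G_β f = ∫_0^∞ e^{-β t} T_t f dt`, for `β > 0`. -/
def resolvent (T : ContractionSemigroup H) (β : ℝ) (f : H) : H :=
  ∫ t in Set.Ioi (0 : ℝ), Real.exp (-(β * t)) • T.op t.toNNReal f

/-- The dual semigroup `(T'_t)_{t ≥ 0}`, consisting of the adjoint operators. -/
def dual [CompleteSpace H] (T : ContractionSemigroup H) : ContractionSemigroup H where
  op t := ContinuousLinearMap.adjoint (T.op t)
  op_zero := by
    rw [T.op_zero]
    exact ContinuousLinearMap.adjoint_id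
  op_add s t := by
    rw [add_comm, T.op_add, ContinuousLinearMap.adjoint_comp]
  norm_op_le t := by
    rw [LinearIsometryEquiv.norm_map]
    exact T.norm_op_le t
  tendsto_op x := by
    have h1 : Tendsto (fun t => 2 * (‖x‖ ^ 2 - inner ℝ x (T.op t x))) (𝓝 0) (𝓝 0) := by
      have h := ((tendsto_const_nhds (x := x)).inner (𝕜 := ℝ) (T.tendsto_op x))
      have h' := (tendsto_const_nhds (x := ‖x‖ ^ 2)).sub h
      simpa [real_inner_self_eq_norm_sq] using h'.const_mul 2
    have h2 : Tendsto (fun t => ‖ContinuousLinearMap.adjoint (T.op t) x - x‖ ^ 2)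
        (𝓝 0) (𝓝 0) := by
      refine squeeze_zero (fun t => by positivity) (fun t => ?_) h1
      rw [norm_sub_sq_real, ContinuousLinearMap.adjoint_inner_left]
      have h3 : ‖ContinuousLinearMap.adjoint (T.op t) x‖ ≤ ‖x‖ := by
        refine (ContinuousLinearMap.le_opNorm _ x).trans ?_
        rw [LinearIsometryEquiv.norm_map]
        exact mul_le_of_le_one_left (norm_nonneg x) (T.norm_op_le t)
      have h4 := pow_le_pow_left₀ (norm_nonneg _) h3 2
      linarith
    rw [tendsto_iff_norm_sub_tendsto_zero]
    have h5 := h2.sqrt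
    simpa [Real.sqrt_sq] using h5

end ContractionSemigroup

/-! ## The function classes `𝒟` and `𝒞` over a sequence of measures

Throughout, `ν 0` is the distinguished (limit) measure and `ν 1, ν 2, …` is the sequence. -/

namespace MoscoSeq

variable {E : Type*} [MeasurableSpace E]

/-- The mixture `𝕄 = ∑_{n ≥ 0} α_n ν_n`. -/
def mixture (α : ℕ → ℝ≥0) (ν : ℕ → Measure E) : Measure E :=
  Measure.sum fun n => α n • ν n

/-- The pairing `⟨φ, ψ⟩_n = ∫ φ ψ dν_n`. -/
def pairing (ν : ℕ → Measure E) (n : ℕ) (φ ψ : E → ℝ) : ℝ :=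
  ∫ x, φ x * ψ x ∂ν n

variable (α : ℕ → ℝ≥0) (ν : ℕ → Measure E)

/-- The class `𝒟` of all `𝕄`-classes `φ` in `⋂_{n ≥ 0} L²(E, ν_n)` such that
`⟨φ, φ⟩_n → ⟨φ, φ⟩_0`. -/
def classD : Set (E →ₘ[mixture α ν] ℝ) :=
  {φ | (∀ n, MemLp φ 2 (ν n)) ∧
    Tendsto (fun n => pairing ν n φ φ) atTop (𝓝 (pairing ν 0 φ φ))}

variable {α}

/-- The elements of `L²(E, ν_n)` that coincide `ν_n`-a.e. with some element of `X`. -/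
def trace (X : Set (E →ₘ[mixture α ν] ℝ)) (n : ℕ) : Set (Lp ℝ 2 (ν n)) :=
  {u | ∃ φ ∈ X, ⇑u =ᵐ[ν n] ⇑φ}

/-- The class `𝒞` of all `φ ∈ 𝒟` such that, for every `n ≥ 1`, some `χ ∈ ℱ` satisfies `φ = χ`
`ν_n`-a.e. (representing sequence), and `⟨φ, ψ⟩_n → ⟨φ, ψ⟩_0` for all `ψ ∈ ℱ`. -/
def classC (F : Submodule ℝ (E →ₘ[mixture α ν] ℝ)) : Set (E →ₘ[mixture α ν] ℝ) :=
  {φ | φ ∈ classD α ν ∧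
    (∀ n, 1 ≤ n → ∃ χ ∈ F, ⇑φ =ᵐ[ν n] ⇑χ) ∧
    ∀ ψ ∈ F, Tendsto (fun n => pairing ν n φ ψ) atTop (𝓝 (pairing ν 0 φ ψ))}

/-- `σ 0 < σ 1 < …` enumerates a subsequence of the indices `1, 2, 3, …`. The whole sequence is
`σ k = k + 1`. -/
def IsSubseq (σ : ℕ → ℕ) : Prop :=
  StrictMono σ ∧ ∀ k, 1 ≤ σ k

variable {ν}

/-- w-convergence, along the indices `n = σ k`, of elements `φ_n` of `𝒞` (given through their
`ν_n`-classes) to `f ∈ L²(E, ν_0)`. -/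
def WConv (F : Submodule ℝ (E →ₘ[mixture α ν] ℝ)) (σ : ℕ → ℕ)
    (φ : ∀ k, Lp ℝ 2 (ν (σ k))) (f : Lp ℝ 2 (ν 0)) : Prop :=
  (∀ k, φ k ∈ trace ν (classC ν F) (σ k)) ∧
    ∀ ψ ∈ classC ν F,
      Tendsto (fun k => pairing ν (σ k) (φ k) ψ) atTop (𝓝 (pairing ν 0 f ψ))

/-- s-convergence, along the indices `n = σ k`: w-convergence together with convergence of the
squared norms. -/
def SConv (F : Submodule ℝ (E →ₘ[mixture α ν] ℝ)) (σ : ℕ → ℕ)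
    (φ : ∀ k, Lp ℝ 2 (ν (σ k))) (f : Lp ℝ 2 (ν 0)) : Prop :=
  WConv F σ φ f ∧
    Tendsto (fun k => inner ℝ (φ k) (φ k)) atTop (𝓝 (inner ℝ f f))

/-- Stability of `𝒞` under the resolvents and the dual resolvents: for all `n ≥ 0` (so for the
limit semigroup `T 0` as well), `β > 0` and `g ∈ 𝒞`, each of `G_{n,β} g` and `G'_{n,β} g`
coincides `ν_n`-a.e. with an element of `𝒞`. -/
def ResolventStable (F : Submodule ℝ (E →ₘ[mixture α ν] ℝ))
    (T : ∀ n, ContractionSemigroup (Lp ℝ 2 (ν n))) : Prop :=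
  ∀ n, ∀ β : ℝ, 0 < β → ∀ g ∈ trace ν (classC ν F) n,
    (T n).resolvent β g ∈ trace ν (classC ν F) n ∧
      (T n).dual.resolvent β g ∈ trace ν (classC ν F) n

/-- `sup_k ⟨A_n u_n, A_n u_n⟩_n < ∞`, where `n = σ k`. -/
def BddGenerators (T : ∀ n, ContractionSemigroup (Lp ℝ 2 (ν n))) (σ : ℕ → ℕ)
    (u : ∀ k, Lp ℝ 2 (ν (σ k))) : Prop :=
  BddAbove (Set.range fun k =>
    inner ℝ ((T (σ k)).generator (u k)) ((T (σ k)).generator (u k)))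

/-- `ψ_n ∈ D(S_n) ∩ 𝒞`, `n = σ k`, is a recovery sequence for `ψ`: it s-converges to `ψ`,
`sup_n ⟨A_n ψ_n, A_n ψ_n⟩_n < ∞`, and `limsup_n S_n(ψ_n, ψ_n) ≤ S(ψ, ψ)`. -/
def IsRecovery (F : Submodule ℝ (E →ₘ[mixture α ν] ℝ))
    (T : ∀ n, ContractionSemigroup (Lp ℝ 2 (ν n))) (σ : ℕ → ℕ)
    (ψs : ∀ k, Lp ℝ 2 (ν (σ k))) (ψ : Lp ℝ 2 (ν 0)) : Prop :=
  (∀ k, ψs k ∈ (T (σ k)).domain) ∧ SConv F σ ψs ψ ∧ BddGenerators T σ ψs ∧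
    limsup (fun k => (((T (σ k)).form (ψs k) (ψs k) : ℝ) : EReal)) atTop
      ≤ (((T 0).form ψ ψ : ℝ) : EReal)

/-- Condition (i). With the convention `S(φ, φ) = ∞` for `φ ∉ D(S)`, the inequality contains the
assertion `φ ∈ D(S)`, which is spelled out. -/
def LowerBound (F : Submodule ℝ (E →ₘ[mixture α ν] ℝ))
    (T : ∀ n, ContractionSemigroup (Lp ℝ 2 (ν n))) : Prop :=
  ∀ σ : ℕ → ℕ, IsSubseq σ → ∀ (φs : ∀ k, Lp ℝ 2 (ν (σ k))) (φ : Lp ℝ 2 (ν 0)),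
    (∀ k, φs k ∈ (T (σ k)).domain) → WConv F σ φs φ → BddGenerators T σ φs →
    φ ∈ (T 0).domain ∧
      (((T 0).form φ φ : ℝ) : EReal) ≤
        liminf (fun k => (((T (σ k)).form (φs k) (φs k) : ℝ) : EReal)) atTop

/-- Condition (ii): every `ψ ∈ D(S)` has a recovery sequence. -/
def HasRecovery (F : Submodule ℝ (E →ₘ[mixture α ν] ℝ))
    (T : ∀ n, ContractionSemigroup (Lp ℝ 2 (ν n))) : Prop :=
  ∀ ψ ∈ (T 0).domain, ∃ ψs : ∀ k, Lp ℝ 2 (ν (k + 1)), IsRecovery F T (fun k => k + 1) ψs ψ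

/-- Condition (iii), required along subsequences of indices. Let `β > 0`, let
`u_n ∈ D(S_n) ∩ 𝒞` with `A_n u_n ∈ 𝒞` be w-convergent with `sup_n ⟨A_n u_n, A_n u_n⟩_n < ∞`, and
let `u ∈ D(S)`. If `S_{n,β}(u_n, ψ_n) → S_β(u, ψ)` whenever `ψ_n ∈ 𝒞` s-converges to `ψ ∈ 𝒞`,
then `S_{n,β}(ψ_n, u_n) → S_β(ψ, u)` for every recovery sequence `ψ_n` of every `ψ ∈ D(S)`. -/
def FormDuality (F : Submodule ℝ (E →ₘ[mixture α ν] ℝ))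
    (T : ∀ n, ContractionSemigroup (Lp ℝ 2 (ν n))) : Prop :=
  ∀ β : ℝ, 0 < β → ∀ σ : ℕ → ℕ, IsSubseq σ →
    ∀ (us : ∀ k, Lp ℝ 2 (ν (σ k))) (u : Lp ℝ 2 (ν 0)),
    (∀ k, us k ∈ (T (σ k)).domain) →
    (∀ k, (T (σ k)).generator (us k) ∈ trace ν (classC ν F) (σ k)) →
    (∃ w, WConv F σ us w) → BddGenerators T σ us → u ∈ (T 0).domain →
    (∀ (ψs : ∀ k, Lp ℝ 2 (ν (σ k))) (ψ : Lp ℝ 2 (ν 0)),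
      ψ ∈ trace ν (classC ν F) 0 → SConv F σ ψs ψ →
      Tendsto (fun k => (T (σ k)).formShift β (us k) (ψs k)) atTop
        (𝓝 ((T 0).formShift β u ψ))) →
    ∀ (ψs : ∀ k, Lp ℝ 2 (ν (σ k))) (ψ : Lp ℝ 2 (ν 0)),
      ψ ∈ (T 0).domain → IsRecovery F T σ ψs ψ →
      Tendsto (fun k => (T (σ k)).formShift β (ψs k) (us k)) atTop
        (𝓝 ((T 0).formShift β ψ u))

/-- The forms `S_1, S_2, …` converge to `S = S_0` in the Mosco-type sense. -/
structure FormsConverge (F : Submodule ℝ (E →ₘ[mixture α ν] ℝ))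
    (T : ∀ n, ContractionSemigroup (Lp ℝ 2 (ν n))) : Prop where
  lowerBound : LowerBound F T
  hasRecovery : HasRecovery F T
  formDuality : FormDuality F T

end MoscoSeq

end

/-! Since the carriers are disjoint and all `α n` are positive, any family of classes `s n` in
`L²(E, ν_n)` glues to a single `𝕄`-class. The measures can then be forgotten: `𝒞` becomes the space
`convSections` of families that elements of `F` approximate in norm, both at `0` and asymptotically.
In this form it is visibly linear, norms and by polarization inner products converge on it, and
every s-convergent sequence is a restriction of one of its members. Hence w-convergent sequences
pair with s-convergent ones in the limit (`Weak.tendsto_inner`), are bounded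
(`Weak.exists_norm_le`), and bounded sequences have w-convergent subsequences
(`exists_weak_subseq`).

The core is `eq_resolvent_of_weak`. Let `f_n` s-converge to `f`, let `u_n = G_{n,β} f_n` w-converge
to `w`, and put `G = G_β f`. Because `S_{n,β}(u_n, ·) = ⟨f_n, ·⟩`, condition (iii) gives
`S_{n,β}(ψ_n, u_n) → S_β(ψ, G)` for every recovery sequence `ψ_n` of `ψ`, before `w = G` is known.
Expanding `S_{n,β}(u_n - ψ_n, u_n - ψ_n)` and using lower semicontinuity yields an inequality for
all `ψ` in `D(S)`. Inserting `ψ = w + ε (w - G)` forces `S_β(w - G, w - G) = 0`, so `w = G`. With `ψ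
= G` the same expansion tends to `0`, and coercivity of `S_β` makes the convergence strong.

The other three claims follow by duality: weak convergence of `G'` from strong convergence of `G`;
weak convergence of `G` from (iii), because resolvents of s-convergent sequences are recovery
sequences; strong convergence of `G'` from `‖G' g‖² = ⟨G G' g, g⟩`. -/

namespace ContractionSemigroup

/-! ### Generator, form and resolvent of a single contraction semigroup. -/

variable {H : Type*} [NormedAddCommGroup H] [InnerProductSpace ℝ H]

theorem norm_op_apply_le (T : ContractionSemigroup H) (t : ℝ≥0) (x : H) : ‖T.op t x‖ ≤ ‖x‖ :=
  (ContinuousLinearMap.le_opNorm _ x).trans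
    (mul_le_of_le_one_left (norm_nonneg x) (T.norm_op_le t))

theorem tendsto_generator {T : ContractionSemigroup H} {u : H} (hu : u ∈ T.domain) :
    Tendsto (fun t : ℝ≥0 => t⁻¹ • (T.op t u - u)) (𝓝[>] 0) (𝓝 (T.generator u)) :=
  tendsto_nhds_limUnder hu

theorem generator_eq {T : ContractionSemigroup H} {u v : H}
    (h : Tendsto (fun t : ℝ≥0 => t⁻¹ • (T.op t u - u)) (𝓝[>] 0) (𝓝 v)) :
    T.generator u = v :=
  h.limUnder_eq

theorem tendsto_generator_add {T : ContractionSemigroup H} {u v : H} (hu : u ∈ T.domain)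
    (hv : v ∈ T.domain) :
    Tendsto (fun t : ℝ≥0 => t⁻¹ • (T.op t (u + v) - (u + v))) (𝓝[>] 0)
      (𝓝 (T.generator u + T.generator v)) := by
  refine ((tendsto_generator hu).add (tendsto_generator hv)).congr fun t => ?_
  rw [← smul_add, map_add]
  congr 1
  abel

theorem tendsto_generator_smul {T : ContractionSemigroup H} (c : ℝ) {u : H}
    (hu : u ∈ T.domain) :
    Tendsto (fun t : ℝ≥0 => t⁻¹ • (T.op t (c • u) - c • u)) (𝓝[>] 0)
      (𝓝 (c • T.generator u)) := by
  refine ((tendsto_generator hu).const_smul c).congr fun t => ?_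
  rw [map_smul, ← smul_sub, smul_comm]

theorem add_mem_domain {T : ContractionSemigroup H} {u v : H} (hu : u ∈ T.domain)
    (hv : v ∈ T.domain) : u + v ∈ T.domain :=
  ⟨_, tendsto_generator_add hu hv⟩

theorem smul_mem_domain {T : ContractionSemigroup H} (c : ℝ) {u : H} (hu : u ∈ T.domain) :
    c • u ∈ T.domain :=
  ⟨_, tendsto_generator_smul c hu⟩

theorem sub_mem_domain {T : ContractionSemigroup H} {u v : H} (hu : u ∈ T.domain)
    (hv : v ∈ T.domain) : u - v ∈ T.domain := by
  rw [sub_eq_add_neg, ← neg_one_smul ℝ v]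
  exact add_mem_domain hu (smul_mem_domain _ hv)

theorem generator_add {T : ContractionSemigroup H} {u v : H} (hu : u ∈ T.domain)
    (hv : v ∈ T.domain) : T.generator (u + v) = T.generator u + T.generator v :=
  generator_eq (tendsto_generator_add hu hv)

theorem generator_smul {T : ContractionSemigroup H} (c : ℝ) {u : H} (hu : u ∈ T.domain) :
    T.generator (c • u) = c • T.generator u :=
  generator_eq (tendsto_generator_smul c hu)

theorem generator_sub {T : ContractionSemigroup H} {u v : H} (hu : u ∈ T.domain)
    (hv : v ∈ T.domain) : T.generator (u - v) = T.generator u - T.generator v := by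
  rw [sub_eq_add_neg, ← neg_one_smul ℝ v, generator_add hu (smul_mem_domain _ hv),
    generator_smul _ hv, neg_one_smul, ← sub_eq_add_neg]

/-- Contractivity and Cauchy–Schwarz give `⟨T_t u - u, u⟩ ≤ 0`, and the sign survives the limit of
the difference quotients. -/
theorem form_self_nonneg {T : ContractionSemigroup H} {u : H} (hu : u ∈ T.domain) :
    0 ≤ T.form u u := by
  rw [form, neg_nonneg]
  refine le_of_tendsto ((tendsto_generator hu).inner (𝕜 := ℝ) tendsto_const_nhds)
    (Eventually.of_forall fun t => ?_)
  rw [NNReal.smul_def, real_inner_smul_left, inner_sub_left, real_inner_self_eq_norm_sq]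
  have h1 := real_inner_le_norm (T.op t u) u
  have h2 := mul_le_mul_of_nonneg_right (T.norm_op_apply_le t u) (norm_nonneg u)
  exact mul_nonpos_of_nonneg_of_nonpos (NNReal.coe_nonneg _) (by nlinarith)

/-- For `t = s + d` the difference is `T_s (x - T_d x)`, and `T_s` is a contraction. Continuity at
`0` thereby spreads to all times. -/
theorem norm_op_sub_op_le (T : ContractionSemigroup H) (s t : ℝ≥0) (x : H) :
    ‖T.op s x - T.op t x‖ ≤ ‖T.op (nndist s t) x - x‖ := by
  wlog h : s ≤ t generalizing s t
  · rw [norm_sub_rev, nndist_comm]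
    exact this t s (le_of_not_ge h)
  obtain ⟨d, rfl⟩ := exists_add_of_le h
  have hd : nndist s (s + d) = d := by
    rw [NNReal.nndist_eq, add_tsub_cancel_left, tsub_eq_zero_of_le h]
    simp
  rw [hd, T.op_add, ContinuousLinearMap.comp_apply, ← map_sub]
  exact (T.norm_op_apply_le s _).trans_eq (norm_sub_rev _ _)

theorem continuous_op_apply (T : ContractionSemigroup H) (x : H) :
    Continuous fun t => T.op t x := by
  refine continuous_iff_continuousAt.2 fun t => tendsto_iff_norm_sub_tendsto_zero.2 ?_
  refine squeeze_zero (fun _ => norm_nonneg _) (fun s => T.norm_op_sub_op_le s t x) ?_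
  have h : Tendsto (fun s : ℝ≥0 => nndist s t) (𝓝 t) (𝓝 0) := by
    have := (continuous_id.nndist (continuous_const (y := t))).tendsto t
    simpa using this
  exact tendsto_iff_norm_sub_tendsto_zero.1 ((T.tendsto_op x).comp h)

/-- The integrand of the resolvent. -/
noncomputable def laplaceIntegrand (T : ContractionSemigroup H) (β : ℝ) (f : H) (t : ℝ) : H :=
  Real.exp (-(β * t)) • T.op t.toNNReal f

theorem continuous_laplaceIntegrand (T : ContractionSemigroup H) (β : ℝ) (f : H) :
    Continuous (T.laplaceIntegrand β f) :=
  (by fun_prop : Continuous fun t : ℝ => Real.exp (-(β * t))).smul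
    ((T.continuous_op_apply f).comp continuous_real_toNNReal)

theorem integrableOn_laplaceIntegrand (T : ContractionSemigroup H) {β : ℝ} (hβ : 0 < β) (f : H)
    (a : ℝ) : IntegrableOn (T.laplaceIntegrand β f) (Set.Ioi a) := by
  refine Integrable.mono' ((exp_neg_integrableOn_Ioi a hβ).mul_const ‖f‖)
    (T.continuous_laplaceIntegrand β f).aestronglyMeasurable.restrict
    (Eventually.of_forall fun t => ?_)
  rw [laplaceIntegrand, norm_smul, Real.norm_eq_abs, Real.abs_exp, neg_mul]
  exact mul_le_mul_of_nonneg_left (T.norm_op_apply_le _ f) (Real.exp_nonneg _)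

theorem resolvent_eq_integral (T : ContractionSemigroup H) (β : ℝ) (f : H) :
    T.resolvent β f = ∫ t in Set.Ioi (0 : ℝ), T.laplaceIntegrand β f t :=
  rfl

variable [CompleteSpace H]

/-- Substituting `t + h` in the Laplace integral leaves a factor `e^{βh}` and the integral over `(h,
∞)`. The right-hand side can be differentiated in `h`. -/
theorem op_resolvent (T : ContractionSemigroup H) {β : ℝ} (hβ : 0 < β) (f : H) {h : ℝ}
    (hh : 0 ≤ h) :
    T.op h.toNNReal (T.resolvent β f) =
      Real.exp (β * h) • (T.resolvent β f - ∫ t in (0 : ℝ)..h, T.laplaceIntegrand β f t) := by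
  have h1 : T.resolvent β f - ∫ t in (0 : ℝ)..h, T.laplaceIntegrand β f t =
      ∫ t in Set.Ioi h, T.laplaceIntegrand β f t := by
    rw [sub_eq_iff_eq_add']
    exact (intervalIntegral.integral_interval_add_Ioi (T.integrableOn_laplaceIntegrand hβ f 0)
      (T.integrableOn_laplaceIntegrand hβ f h)).symm
  have h2 : ∫ t in Set.Ioi h, T.laplaceIntegrand β f t =
      ∫ t in Set.Ioi (0 : ℝ), T.laplaceIntegrand β f (t + h) := by
    rw [← (measurePreserving_add_right volume h).setIntegral_preimage_emb
      (measurableEmbedding_addRight h)]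
    simp
  rw [h1, h2, ← integral_smul, resolvent_eq_integral,
    ← ContinuousLinearMap.integral_comp_comm _ (T.integrableOn_laplaceIntegrand hβ f 0)]
  refine setIntegral_congr_fun measurableSet_Ioi fun t ht => ?_
  simp only [laplaceIntegrand]
  rw [map_smul, smul_smul, ← Real.exp_add, add_comm t h, Real.toNNReal_add hh (le_of_lt ht),
    T.op_add, ContinuousLinearMap.comp_apply]
  congr 2
  ring

/-- Product rule at `h = 0` for the formula of `op_resolvent`: the exponential contributes `β G_β
f`, the integral `-f`. -/
theorem tendsto_generator_resolvent (T : ContractionSemigroup H) {β : ℝ} (hβ : 0 < β) (f : H) :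
    Tendsto (fun t : ℝ≥0 => t⁻¹ • (T.op t (T.resolvent β f) - T.resolvent β f)) (𝓝[>] 0)
      (𝓝 (β • T.resolvent β f - f)) := by
  have h1 : HasDerivAt (fun h : ℝ => ∫ t in (0 : ℝ)..h, T.laplaceIntegrand β f t)
      (T.laplaceIntegrand β f 0) 0 :=
    (T.continuous_laplaceIntegrand β f).integral_hasStrictDerivAt 0 0 |>.hasDerivAt
  have h2 : HasDerivAt (fun h : ℝ => Real.exp (β * h)) β 0 := by
    simpa using ((hasDerivAt_id (0 : ℝ)).const_mul β).exp
  have h3 := (h2.smul (h1.const_sub (T.resolvent β f))).tendsto_slope_zero_right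
  have h4 : Tendsto ((↑) : ℝ≥0 → ℝ) (𝓝[>] 0) (𝓝[>] 0) :=
    tendsto_nhdsWithin_iff.2 ⟨(NNReal.continuous_coe.tendsto 0).mono_left nhdsWithin_le_nhds,
      eventually_nhdsWithin_of_forall fun t ht => NNReal.coe_pos.2 ht⟩
  have h5 := h3.comp h4
  have h6 : T.laplaceIntegrand β f 0 = f := by simp [laplaceIntegrand, T.op_zero]
  simp only [h6, intervalIntegral.integral_same, mul_zero, Real.exp_zero, one_smul, sub_zero,
    zero_add] at h5
  rw [sub_eq_neg_add]
  refine h5.congr fun t => ?_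
  have h7 := T.op_resolvent hβ f t.coe_nonneg
  rw [Real.toNNReal_coe] at h7
  simp [h7, NNReal.smul_def]

theorem resolvent_mem_domain (T : ContractionSemigroup H) {β : ℝ} (hβ : 0 < β) (f : H) :
    T.resolvent β f ∈ T.domain :=
  ⟨_, T.tendsto_generator_resolvent hβ f⟩

theorem generator_resolvent (T : ContractionSemigroup H) {β : ℝ} (hβ : 0 < β) (f : H) :
    T.generator (T.resolvent β f) = β • T.resolvent β f - f :=
  generator_eq (T.tendsto_generator_resolvent hβ f)

theorem formShift_resolvent (T : ContractionSemigroup H) {β : ℝ} (hβ : 0 < β) (f v : H) :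
    T.formShift β (T.resolvent β f) v = inner ℝ f v := by
  rw [formShift, form, T.generator_resolvent hβ, inner_sub_left, real_inner_smul_left]
  ring

/-- Nonnegativity of the form gives `β ‖G_β f‖² ≤ S_β(G_β f, G_β f) = ⟨f, G_β f⟩`. -/
theorem norm_resolvent_le (T : ContractionSemigroup H) {β : ℝ} (hβ : 0 < β) (f : H) :
    ‖T.resolvent β f‖ ≤ β⁻¹ * ‖f‖ := by
  have h1 := T.formShift_resolvent hβ f (T.resolvent β f)
  rw [formShift, real_inner_self_eq_norm_sq] at h1
  have h2 := form_self_nonneg (T.resolvent_mem_domain hβ f)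
  have h3 := real_inner_le_norm f (T.resolvent β f)
  rw [← div_eq_inv_mul, le_div_iff₀ hβ]
  rcases (norm_nonneg (T.resolvent β f)).eq_or_lt with h | h
  · rw [← h]
    simp
  · nlinarith

theorem inner_dual_resolvent (T : ContractionSemigroup H) {β : ℝ} (hβ : 0 < β) (f g : H) :
    inner ℝ (T.dual.resolvent β f) g = inner ℝ f (T.resolvent β g) := by
  rw [real_inner_comm, resolvent_eq_integral, resolvent_eq_integral,
    ← integral_inner (T.dual.integrableOn_laplaceIntegrand hβ f 0),
    ← integral_inner (T.integrableOn_laplaceIntegrand hβ g 0)]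
  refine integral_congr_ae (Eventually.of_forall fun t => ?_)
  simp only [laplaceIntegrand, dual, real_inner_smul_right]
  rw [ContinuousLinearMap.adjoint_inner_right, real_inner_comm]

end ContractionSemigroup

/-! ### Weak and strong convergence along a sequence of Hilbert spaces. -/

namespace HilbertSeq

open MoscoSeq (IsSubseq)

theorem isSubseq_succ : IsSubseq fun k => k + 1 :=
  ⟨fun _ _ h => Nat.succ_lt_succ h, fun _ => Nat.le_add_left 1 _⟩

theorem IsSubseq.comp {σ τ : ℕ → ℕ} (hσ : IsSubseq σ) (hτ : StrictMono τ) :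
    IsSubseq fun k => σ (τ k) :=
  ⟨hσ.1.comp hτ, fun _ => hσ.2 _⟩

/-- A property that holds eventually along a subsequence of the indices and eventually off it
holds eventually. -/
theorem eventually_of_subseq {σ : ℕ → ℕ} (hσ : StrictMono σ) {p : ℕ → Prop}
    (h1 : ∀ᶠ k in atTop, p (σ k)) (h2 : ∀ᶠ n in atTop, n ∉ Set.range σ → p n) :
    ∀ᶠ n in atTop, p n := by
  obtain ⟨K, hK⟩ := eventually_atTop.1 h1
  filter_upwards [h2, eventually_ge_atTop (σ K)] with n hn hKn
  by_cases h : n ∈ Set.range σ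
  · obtain ⟨k, rfl⟩ := h
    exact hK k (hσ.le_iff_le.1 hKn)
  · exact hn h

theorem tendsto_of_subseq {X : Type*} {σ : ℕ → ℕ} (hσ : StrictMono σ) {a b : ℕ → X}
    {l : Filter X} (hab : ∀ n, n ∉ Set.range σ → a n = b n) (hb : Tendsto b atTop l)
    (ha : Tendsto (fun k => a (σ k)) atTop l) : Tendsto a atTop l := by
  intro s hs
  refine eventually_of_subseq hσ (ha hs) ?_
  filter_upwards [hb hs] with n hn hnσ
  rw [hab n hnσ]
  exact hn

variable {H : ℕ → Type*}

/-- A sequence along `σ` can be completed by a given family to a family over all indices. -/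
theorem exists_extension {σ : ℕ → ℕ} (hσ : StrictMono σ) (φ : ∀ k, H (σ k)) (b : ∀ n, H n) :
    ∃ s : ∀ n, H n, (∀ k, s (σ k) = φ k) ∧ ∀ n, n ∉ Set.range σ → s n = b n := by
  -- Heterogeneous equality is needed because `x` and `φ k` have the same type only once `σ k = n`
  -- is substituted.
  have h : ∀ n, ∃ x : H n, (∀ k, σ k = n → HEq x (φ k)) ∧ (n ∉ Set.range σ → x = b n) := by
    intro n
    by_cases hn : n ∈ Set.range σ
    · obtain ⟨k, rfl⟩ := hn
      refine ⟨φ k, fun j hj => ?_, fun hk => absurd ⟨k, rfl⟩ hk⟩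
      rw [hσ.injective hj]
    · exact ⟨b n, fun k hk => absurd ⟨k, hk⟩ hn, fun _ => rfl⟩
  choose s hs1 hs2 using h
  exact ⟨s, fun k => eq_of_heq (hs1 _ k rfl), hs2⟩

variable [∀ n, NormedAddCommGroup (H n)] [∀ n, InnerProductSpace ℝ (H n)]

/-- The families that are approximated by `F`: `φ n` belongs to the `n`-th component of `F` for
`n ≥ 1`, and for every `ε > 0` some `χ ∈ F` is `ε`-close to `φ` at `0` and at all large `n`. -/
def convSections (F : Submodule ℝ (∀ n, H n)) : Submodule ℝ (∀ n, H n) where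
  carrier := {φ | (∀ n, 1 ≤ n → ∃ χ ∈ F, φ n = χ n) ∧
    ∀ ε > 0, ∃ χ ∈ F, ‖φ 0 - χ 0‖ < ε ∧ ∀ᶠ n in atTop, ‖φ n - χ n‖ < ε}
  zero_mem' := ⟨fun _ _ => ⟨0, F.zero_mem, rfl⟩, fun ε hε => ⟨0, F.zero_mem, by simpa,
    Eventually.of_forall fun n => by simpa⟩⟩
  add_mem' := by
    rintro φ ψ ⟨hφ, hφ'⟩ ⟨hψ, hψ'⟩
    refine ⟨fun n hn => ?_, fun ε hε => ?_⟩
    · obtain ⟨χ, hχ, h⟩ := hφ n hn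
      obtain ⟨χ', hχ', h'⟩ := hψ n hn
      exact ⟨χ + χ', F.add_mem hχ hχ', by simp [h, h']⟩
    · obtain ⟨χ, hχ, h0, h⟩ := hφ' (ε / 2) (half_pos hε)
      obtain ⟨χ', hχ', h0', h'⟩ := hψ' (ε / 2) (half_pos hε)
      refine ⟨χ + χ', F.add_mem hχ hχ', ?_, ?_⟩
      · simp only [Pi.add_apply, add_sub_add_comm]
        linarith [norm_add_le (φ 0 - χ 0) (ψ 0 - χ' 0)]
      · filter_upwards [h, h'] with n hn hn'
        simp only [Pi.add_apply, add_sub_add_comm]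
        linarith [norm_add_le (φ n - χ n) (ψ n - χ' n)]
  smul_mem' := by
    rintro c φ ⟨hφ, hφ'⟩
    refine ⟨fun n hn => ?_, fun ε hε => ?_⟩
    · obtain ⟨χ, hχ, h⟩ := hφ n hn
      exact ⟨c • χ, F.smul_mem c hχ, by simp [h]⟩
    · have hc : 0 < |c| + 1 := by positivity
      obtain ⟨χ, hχ, h0, h⟩ := hφ' (ε / (|c| + 1)) (div_pos hε hc)
      have key : ∀ x : ℝ, 0 ≤ x → x < ε / (|c| + 1) → |c| * x < ε := by
        intro x hx hxε
        rw [lt_div_iff₀ hc] at hxε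
        nlinarith
      refine ⟨c • χ, F.smul_mem c hχ, ?_, ?_⟩
      · simp only [Pi.smul_apply, ← smul_sub, norm_smul, Real.norm_eq_abs]
        exact key _ (norm_nonneg _) h0
      · filter_upwards [h] with n hn
        simp only [Pi.smul_apply, ← smul_sub, norm_smul, Real.norm_eq_abs]
        exact key _ (norm_nonneg _) hn

variable {F : Submodule ℝ (∀ n, H n)}

theorem le_convSections : F ≤ convSections F := fun φ hφ =>
  ⟨fun _ _ => ⟨φ, hφ, rfl⟩, fun ε hε => ⟨φ, hφ, by simpa,
    Eventually.of_forall fun n => by simpa⟩⟩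

/-- `φ` belongs to the fibre of `F` along `σ`. -/
def InFibres (F : Submodule ℝ (∀ n, H n)) (σ : ℕ → ℕ) (φ : ∀ k, H (σ k)) : Prop :=
  ∀ k, ∃ χ ∈ F, φ k = χ (σ k)

/-- Weak convergence along the indices `σ k`, tested against `convSections F`. -/
def Weak (F : Submodule ℝ (∀ n, H n)) (σ : ℕ → ℕ) (φ : ∀ k, H (σ k)) (f : H 0) : Prop :=
  InFibres F σ φ ∧ ∀ ψ ∈ convSections F,
    Tendsto (fun k => inner ℝ (φ k) (ψ (σ k))) atTop (𝓝 (inner ℝ f (ψ 0)))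

/-- Strong convergence: weak convergence and convergence of the norms. -/
def Strong (F : Submodule ℝ (∀ n, H n)) (σ : ℕ → ℕ) (φ : ∀ k, H (σ k)) (f : H 0) : Prop :=
  Weak F σ φ f ∧ Tendsto (fun k => ‖φ k‖) atTop (𝓝 ‖f‖)

theorem InFibres.sub {σ : ℕ → ℕ} {φ ψ : ∀ k, H (σ k)} (hφ : InFibres F σ φ)
    (hψ : InFibres F σ ψ) : InFibres F σ fun k => φ k - ψ k := by
  intro k
  obtain ⟨χ, hχ, h⟩ := hφ k
  obtain ⟨χ', hχ', h'⟩ := hψ k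
  exact ⟨χ - χ', F.sub_mem hχ hχ', by simp [h, h']⟩

theorem InFibres.smul {σ : ℕ → ℕ} {φ : ∀ k, H (σ k)} (hφ : InFibres F σ φ) (c : ℕ → ℝ) :
    InFibres F σ fun k => c k • φ k := by
  intro k
  obtain ⟨χ, hχ, h⟩ := hφ k
  exact ⟨c k • χ, F.smul_mem _ hχ, by simp [h]⟩

theorem Weak.sub {σ : ℕ → ℕ} {φ ψ : ∀ k, H (σ k)} {f g : H 0} (hφ : Weak F σ φ f)
    (hψ : Weak F σ ψ g) : Weak F σ (fun k => φ k - ψ k) (f - g) := by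
  refine ⟨hφ.1.sub hψ.1, fun χ hχ => ?_⟩
  simpa only [inner_sub_left] using (hφ.2 χ hχ).sub (hψ.2 χ hχ)

theorem Weak.comp {σ τ : ℕ → ℕ} {φ : ∀ k, H (σ k)} {f : H 0} (hφ : Weak F σ φ f)
    (hτ : StrictMono τ) : Weak F (fun k => σ (τ k)) (fun k => φ (τ k)) f :=
  ⟨fun k => hφ.1 (τ k), fun ψ hψ => (hφ.2 ψ hψ).comp hτ.tendsto_atTop⟩

theorem Strong.comp {σ τ : ℕ → ℕ} {φ : ∀ k, H (σ k)} {f : H 0} (hφ : Strong F σ φ f)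
    (hτ : StrictMono τ) : Strong F (fun k => σ (τ k)) (fun k => φ (τ k)) f :=
  ⟨hφ.1.comp hτ, hφ.2.comp hτ.tendsto_atTop⟩

theorem exists_mem_norm_sub_lt (hd : Dense ((fun φ : ∀ n, H n => φ 0) '' F)) (f : H 0) {ε : ℝ}
    (hε : 0 < ε) : ∃ χ ∈ F, ‖f - χ 0‖ < ε := by
  obtain ⟨_, h, ⟨χ, hχ, rfl⟩⟩ := Metric.dense_iff.1 hd f ε hε
  exact ⟨χ, hχ, by rwa [Metric.mem_ball, dist_comm, dist_eq_norm] at h⟩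

theorem tendsto_norm
    (hF : ∀ φ ∈ F, Tendsto (fun n => ‖φ n‖) atTop (𝓝 ‖φ 0‖))
    {φ : ∀ n, H n} (hφ : φ ∈ convSections F) :
    Tendsto (fun n => ‖φ n‖) atTop (𝓝 ‖φ 0‖) := by
  refine Metric.tendsto_nhds.2 fun ε hε => ?_
  obtain ⟨χ, hχ, h0, h⟩ := hφ.2 (ε / 3) (by positivity)
  filter_upwards [h, Metric.tendsto_nhds.1 (hF χ hχ) (ε / 3) (by positivity)] with n hn hn'
  rw [Real.dist_eq] at hn' ⊢
  have h1 := (abs_norm_sub_norm_le (φ n) (χ n)).trans_lt hn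
  have h2 := (abs_norm_sub_norm_le (φ 0) (χ 0)).trans_lt h0
  rw [abs_lt] at *
  constructor <;> linarith [h1.1, h1.2, h2.1, h2.2, hn'.1, hn'.2]

/-- Polarization: the sum of two sections is a section, so the three norms involved converge. -/
theorem tendsto_inner
    (hF : ∀ φ ∈ F, Tendsto (fun n => ‖φ n‖) atTop (𝓝 ‖φ 0‖))
    {φ ψ : ∀ n, H n} (hφ : φ ∈ convSections F) (hψ : ψ ∈ convSections F) :
    Tendsto (fun n => inner ℝ (φ n) (ψ n)) atTop (𝓝 (inner ℝ (φ 0) (ψ 0))) := by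
  simp only [real_inner_eq_norm_add_mul_self_sub_norm_mul_self_sub_norm_mul_self_div_two]
  have h1 := tendsto_norm hF ((convSections F).add_mem hφ hψ)
  have h2 := tendsto_norm hF hφ
  have h3 := tendsto_norm hF hψ
  exact (((h1.mul h1).sub (h2.mul h2)).sub (h3.mul h3)).div_const 2

theorem strong_of_mem
    (hF : ∀ φ ∈ F, Tendsto (fun n => ‖φ n‖) atTop (𝓝 ‖φ 0‖))
    {ψ : ∀ n, H n} (hψ : ψ ∈ convSections F) {σ : ℕ → ℕ} (hσ : IsSubseq σ) :
    Strong F σ (fun k => ψ (σ k)) (ψ 0) :=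
  ⟨⟨fun k => hψ.1 _ (hσ.2 k), fun _ hχ => (tendsto_inner hF hψ hχ).comp hσ.1.tendsto_atTop⟩,
    (tendsto_norm hF hψ).comp hσ.1.tendsto_atTop⟩

/-- Expanding the square shows `‖s n - χ n‖² → ‖s 0 - χ 0‖²` for `χ` in `F`; so closeness at `0`,
available by density, passes to all large `n`. -/
theorem mem_convSections_of_tendsto
    (hF : ∀ φ ∈ F, Tendsto (fun n => ‖φ n‖) atTop (𝓝 ‖φ 0‖))
    (hd : Dense ((fun φ : ∀ n, H n => φ 0) '' F))
    {s : ∀ n, H n} (h1 : ∀ n, 1 ≤ n → ∃ χ ∈ F, s n = χ n)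
    (h2 : Tendsto (fun n => ‖s n‖) atTop (𝓝 ‖s 0‖))
    (h3 : ∀ ψ ∈ F, Tendsto (fun n => inner ℝ (s n) (ψ n)) atTop (𝓝 (inner ℝ (s 0) (ψ 0)))) :
    s ∈ convSections F := by
  refine ⟨h1, fun ε hε => ?_⟩
  obtain ⟨χ, hχ, h⟩ := exists_mem_norm_sub_lt hd (s 0) hε
  refine ⟨χ, hχ, h, ?_⟩
  have h4 := ((h2.pow 2).sub ((h3 χ hχ).const_mul 2)).add ((hF χ hχ).pow 2)
  simp only [← norm_sub_sq_real] at h4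
  filter_upwards [h4.eventually_lt_const (pow_lt_pow_left₀ h (norm_nonneg _) two_ne_zero)]
    with n hn
  exact lt_of_pow_lt_pow_left₀ 2 hε.le hn

/-- Every element of `H 0` extends to a family in `convSections F`, by a diagonal argument. -/
theorem exists_convSection
    (hF : ∀ φ ∈ F, Tendsto (fun n => ‖φ n‖) atTop (𝓝 ‖φ 0‖))
    (hd : Dense ((fun φ : ∀ n, H n => φ 0) '' F))
    (f : H 0) : ∃ s ∈ convSections F, s 0 = f := by
  have hpos : ∀ m : ℕ, 0 < 1 / ((m : ℝ) + 1) := fun m => Nat.one_div_pos_of_nat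
  choose χ hχ hχf using fun m : ℕ => exists_mem_norm_sub_lt hd f (hpos m)
  -- At index `n`, the approximant `χ m` is almost as close to all earlier ones as it is at index
  -- `0`. The diagonal family uses the largest such `m ≤ n`; `P n 0` always holds.
  let P : ℕ → ℕ → Prop := fun n m =>
    ∀ i ≤ m, ‖χ m n - χ i n‖ < ‖χ m 0 - χ i 0‖ + 1 / ((m : ℝ) + 1)
  have hP : ∀ m, ∀ᶠ n in atTop, P n m := by
    intro m
    refine (Set.finite_Iic m).eventually_all.2 fun i _ => ?_
    exact (hF _ (F.sub_mem (hχ m) (hχ i))).eventually_lt_const (lt_add_of_pos_right _ (hpos m))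
  classical
  let M : ℕ → ℕ := fun n => Nat.findGreatest (P n) n
  have hPM : ∀ n, P n (M n) := fun n => by
    refine Nat.findGreatest_spec (P := P n) (Nat.zero_le n) fun i hi => ?_
    obtain rfl := Nat.le_zero.1 hi
    simp
  have hM : Tendsto M atTop atTop := by
    refine tendsto_atTop.2 fun m => ?_
    filter_upwards [hP m, eventually_ge_atTop m] with n hn hmn
    exact Nat.le_findGreatest hmn hn
  refine ⟨Function.update (fun n => χ (M n) n) 0 f, ⟨fun n hn => ⟨χ (M n), hχ _, ?_⟩,
    fun ε hε => ?_⟩, by simp⟩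
  · rw [Function.update_of_ne (by omega)]
  -- Three errors of at most `1 / (j + 1)` add up below: those of `χ (M n)` and `χ j` at index `0`,
  -- and the slack in `P`.
  · obtain ⟨j, hj⟩ := exists_nat_one_div_lt (by positivity : 0 < ε / 3)
    refine ⟨χ j, hχ j, ?_, ?_⟩
    · rw [Function.update_self]
      linarith [hχf j]
    · filter_upwards [hM.eventually_ge_atTop j, eventually_ge_atTop 1] with n hjn hn
      rw [Function.update_of_ne (by omega)]
      have h1 := hPM n j hjn
      have h2 := norm_sub_le_norm_sub_add_norm_sub (χ (M n) 0) f (χ j 0)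
      rw [norm_sub_rev (χ (M n) 0) f] at h2
      have h3 := hχf (M n)
      have h4 := hχf j
      have h5 := Nat.one_div_le_one_div (α := ℝ) hjn
      linarith

/-- A strongly convergent sequence is the restriction of a family in `convSections F`. -/
theorem Strong.exists_convSection
    (hF : ∀ φ ∈ F, Tendsto (fun n => ‖φ n‖) atTop (𝓝 ‖φ 0‖))
    (hd : Dense ((fun φ : ∀ n, H n => φ 0) '' F))
    {σ : ℕ → ℕ} (hσ : IsSubseq σ) {φ : ∀ k, H (σ k)} {f : H 0}
    (h : Strong F σ φ f) : ∃ s ∈ convSections F, s 0 = f ∧ ∀ k, s (σ k) = φ k := by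
  obtain ⟨b, hb, rfl⟩ := HilbertSeq.exists_convSection hF hd f
  -- Off the subsequence `s` follows a section `b` through `f`. Index `0` is never of the form `σ
  -- k`, so `s 0 = f`.
  obtain ⟨s, hs, hsb⟩ := exists_extension hσ.1 φ b
  have hs0 : s 0 = b 0 := hsb 0 fun ⟨k, hk⟩ => by
    have := hσ.2 k
    omega
  refine ⟨s, mem_convSections_of_tendsto hF hd (fun n hn => ?_) ?_ fun ψ hψ => ?_, hs0, hs⟩
  · by_cases hnσ : n ∈ Set.range σ
    · obtain ⟨k, rfl⟩ := hnσ
      rw [hs]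
      exact h.1.1 k
    · rw [hsb n hnσ]
      exact hb.1 n hn
  · rw [hs0]
    refine tendsto_of_subseq hσ.1 (fun n hn => by rw [hsb n hn]) (tendsto_norm hF hb) ?_
    simpa only [hs] using h.2
  · rw [hs0]
    refine tendsto_of_subseq hσ.1 (fun n hn => by rw [hsb n hn])
      (tendsto_inner hF hb (le_convSections hψ)) ?_
    simpa only [hs] using h.1.2 ψ (le_convSections hψ)

/-- A strongly convergent sequence is the restriction of a section, so it is itself a legitimate
test sequence. -/
theorem Weak.tendsto_inner
    (hF : ∀ φ ∈ F, Tendsto (fun n => ‖φ n‖) atTop (𝓝 ‖φ 0‖))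
    (hd : Dense ((fun φ : ∀ n, H n => φ 0) '' F))
    {σ : ℕ → ℕ} (hσ : IsSubseq σ) {φ ψ : ∀ k, H (σ k)} {f g : H 0}
    (hφ : Weak F σ φ f) (hψ : Strong F σ ψ g) :
    Tendsto (fun k => inner ℝ (φ k) (ψ k)) atTop (𝓝 (inner ℝ f g)) := by
  obtain ⟨s, hs, rfl, hsψ⟩ := hψ.exists_convSection hF hd hσ
  simpa only [hsψ] using hφ.2 s hs

/-- Weakly convergent sequences are bounded. -/
theorem Weak.exists_norm_le
    (hF : ∀ φ ∈ F, Tendsto (fun n => ‖φ n‖) atTop (𝓝 ‖φ 0‖))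
    (hd : Dense ((fun φ : ∀ n, H n => φ 0) '' F))
    {σ : ℕ → ℕ} (hσ : IsSubseq σ) {φ : ∀ k, H (σ k)} {f : H 0}
    (hφ : Weak F σ φ f) : ∃ M, ∀ k, ‖φ k‖ ≤ M := by
  by_contra! hM
  have h1 : ∀ C : ℝ, ∃ᶠ k in atTop, C ≤ ‖φ k‖ := by
    intro C
    refine frequently_atTop.2 fun N => ?_
    obtain ⟨M, hM'⟩ := ((Set.finite_Iic N).image fun k => ‖φ k‖).bddAbove
    obtain ⟨k, hk⟩ := hM (max C M)
    refine ⟨k, le_of_not_ge fun hkN => ?_, (le_max_left _ _).trans hk.le⟩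
    exact absurd (hM' ⟨k, hkN, rfl⟩) (not_le.2 ((le_max_right _ _).trans_lt hk))
  -- Growth of order `(n + 1)²` lets `φ (τ n)`, rescaled to norm `1 / (n + 1)`, converge strongly to
  -- `0` while its inner product with `φ (τ n)` is still at least `n + 1`.
  obtain ⟨τ, hτ, hτφ⟩ := extraction_forall_of_frequently fun n : ℕ => h1 (((n : ℝ) + 1) ^ 2)
  have hpos : ∀ n, 0 < ‖φ (τ n)‖ := fun n => lt_of_lt_of_le (by positivity) (hτφ n)
  let ψ : ∀ n, H (σ (τ n)) := fun n => (1 / ((n : ℝ) + 1) * ‖φ (τ n)‖⁻¹) • φ (τ n)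
  have hψn : ∀ n, ‖ψ n‖ = 1 / ((n : ℝ) + 1) := by
    intro n
    simp only [ψ]
    rw [norm_smul, Real.norm_of_nonneg (by positivity), mul_assoc,
      inv_mul_cancel₀ (hpos n).ne', mul_one]
  have hψ0 : Tendsto (fun n => ‖ψ n‖) atTop (𝓝 0) := by
    simpa only [hψn] using tendsto_one_div_add_atTop_nhds_zero_nat
  have hψ : Strong F (fun n => σ (τ n)) ψ 0 := by
    refine ⟨⟨(hφ.comp hτ).1.smul _, fun χ hχ => ?_⟩, by simpa using hψ0⟩
    rw [inner_zero_left]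
    refine squeeze_zero_norm (fun n => norm_inner_le_norm _ _) ?_
    simpa using hψ0.mul ((tendsto_norm hF hχ).comp (IsSubseq.comp hσ hτ).1.tendsto_atTop)
  have h2 := (hφ.comp hτ).tendsto_inner hF hd (IsSubseq.comp hσ hτ) hψ
  refine not_tendsto_atTop_of_tendsto_nhds h2 (tendsto_atTop_mono (fun n => ?_)
    tendsto_natCast_atTop_atTop)
  simp only [ψ]
  rw [real_inner_smul_right, real_inner_self_eq_norm_sq]
  have h3 := hτφ n
  have h4 := hpos n
  have h5 : 1 / ((n : ℝ) + 1) * ‖φ (τ n)‖⁻¹ * ‖φ (τ n)‖ ^ 2 = ‖φ (τ n)‖ / ((n : ℝ) + 1) := by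
    field_simp
  rw [h5, le_div_iff₀ (by positivity)]
  nlinarith [(Nat.cast_nonneg n : (0 : ℝ) ≤ n)]

theorem Strong.of_norm_sub
    (hF : ∀ φ ∈ F, Tendsto (fun n => ‖φ n‖) atTop (𝓝 ‖φ 0‖))
    {σ : ℕ → ℕ} {φ ψ : ∀ k, H (σ k)} {f : H 0}
    (hφ : InFibres F σ φ) (hψ : Strong F σ ψ f) (hσ : IsSubseq σ)
    (h : Tendsto (fun k => ‖φ k - ψ k‖) atTop (𝓝 0)) : Strong F σ φ f := by
  refine ⟨⟨hφ, fun χ hχ => ?_⟩, ?_⟩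
  · have h1 : Tendsto (fun k => inner ℝ (φ k - ψ k) (χ (σ k))) atTop (𝓝 0) := by
      refine squeeze_zero_norm (fun n => norm_inner_le_norm _ _) ?_
      simpa using h.mul ((tendsto_norm hF hχ).comp hσ.1.tendsto_atTop)
    simpa [inner_sub_left] using h1.add (hψ.1.2 χ hχ)
  · have h1 : Tendsto (fun k => ‖φ k‖ - ‖ψ k‖) atTop (𝓝 0) :=
      squeeze_zero_norm (fun k => abs_norm_sub_norm_le _ _) h
    simpa using h1.add hψ.2

end HilbertSeq

/-! ### Weak sequential compactness. -/

namespace HilbertSeq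

open MoscoSeq (IsSubseq)

variable {H : ℕ → Type*} [∀ n, NormedAddCommGroup (H n)] [∀ n, InnerProductSpace ℝ (H n)]
  {F : Submodule ℝ (∀ n, H n)}

/-- Every sequence of `F` has a countable subfamily with dense `0`-components. -/
theorem exists_countable_family [TopologicalSpace.SeparableSpace (H 0)]
    (hd : Dense ((fun φ : ∀ n, H n => φ 0) '' F)) :
    ∃ χ : ℕ × ℕ → ∀ n, H n, (∀ p, χ p ∈ F) ∧ ∀ f, ∀ ε > 0, ∃ p, ‖f - χ p 0‖ < ε := by
  have hpos : ∀ m : ℕ, 0 < 1 / ((m : ℝ) + 1) := fun m => Nat.one_div_pos_of_nat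
  choose χ hχ hχf using fun p : ℕ × ℕ =>
    exists_mem_norm_sub_lt hd (TopologicalSpace.denseSeq (H 0) p.1) (hpos p.2)
  refine ⟨χ, hχ, fun f ε hε => ?_⟩
  obtain ⟨m, hm⟩ := exists_nat_one_div_lt (half_pos hε)
  obtain ⟨_, hi, ⟨i, rfl⟩⟩ :=
    Metric.dense_iff.1 (TopologicalSpace.denseRange_denseSeq (H 0)) f (ε / 2) (half_pos hε)
  rw [Metric.mem_ball, dist_comm, dist_eq_norm] at hi
  refine ⟨(i, m), ?_⟩
  have h1 := hχf (i, m)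
  have h2 := norm_sub_le_norm_sub_add_norm_sub f (TopologicalSpace.denseSeq (H 0) i)
    (χ (i, m) 0)
  simp only at h1
  linarith

/-- The pairings with a countable family lie in a countable product of compact intervals, which
yields the subsequence. Density at `0` and boundedness extend the convergence to all sections. -/
theorem exists_subseq_tendsto_inner [TopologicalSpace.SeparableSpace (H 0)]
    (hF : ∀ φ ∈ F, Tendsto (fun n => ‖φ n‖) atTop (𝓝 ‖φ 0‖))
    (hd : Dense ((fun φ : ∀ n, H n => φ 0) '' F))
    {σ : ℕ → ℕ} (hσ : IsSubseq σ) {φ : ∀ k, H (σ k)} {M : ℝ} (hM : ∀ k, ‖φ k‖ ≤ M) :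
    ∃ τ : ℕ → ℕ, StrictMono τ ∧ ∀ ψ ∈ convSections F,
      ∃ l, Tendsto (fun k => inner ℝ (φ (τ k)) (ψ (σ (τ k)))) atTop (𝓝 l) := by
  have hM0 : 0 ≤ M := (norm_nonneg _).trans (hM 0)
  obtain ⟨χ, hχ, hχd⟩ := exists_countable_family hd
  choose B hB using fun p => (hF (χ p) (hχ p)).bddAbove_range
  let x : ℕ → ℕ × ℕ → ℝ := fun k p => inner ℝ (φ k) (χ p (σ k))
  have hx : ∀ k, x k ∈ Set.pi Set.univ fun p => Set.Icc (-(M * B p)) (M * B p) := by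
    intro k p _
    exact abs_le.1 <| (abs_real_inner_le_norm _ _).trans
      (mul_le_mul (hM k) (hB p ⟨_, rfl⟩) (norm_nonneg _) hM0)
  obtain ⟨y, -, τ, hτ, hy⟩ :=
    (isCompact_univ_pi fun p => isCompact_Icc).tendsto_subseq hx
  refine ⟨τ, hτ, fun ψ hψ => cauchySeq_tendsto_of_complete ?_⟩
  refine Metric.cauchySeq_iff'.2 fun ε hε => ?_
  -- The denominator uses `M + 1` because `M` may vanish.
  have hδ : 0 < ε / (3 * (M + 1)) := by positivity
  obtain ⟨p, hp⟩ := hχd (ψ 0) _ hδ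
  have h1 : ∀ᶠ n in atTop, ‖ψ n - χ p n‖ < ε / (3 * (M + 1)) :=
    (tendsto_norm hF ((convSections F).sub_mem hψ
      (le_convSections (hχ p)))).eventually_lt_const hp
  have h2 : ∀ᶠ k in atTop,
      |inner ℝ (φ (τ k)) (ψ (σ (τ k))) - x (τ k) p| < ε / 3 := by
    filter_upwards [(IsSubseq.comp hσ hτ).1.tendsto_atTop.eventually h1] with k hk
    simp only [x]
    rw [← inner_sub_right]
    refine (abs_real_inner_le_norm _ _).trans_lt ?_
    have h3 := mul_le_mul (hM (τ k)) hk.le (norm_nonneg _) hM0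
    refine h3.trans_lt ?_
    rw [mul_div_assoc', div_lt_div_iff₀ (by positivity) (by positivity)]
    nlinarith
  -- Two indices are compared through `N`, so `ε / 6` yields `ε / 3`.
  obtain ⟨N, hN⟩ := Metric.cauchySeq_iff'.1 (tendsto_pi_nhds.1 hy p).cauchySeq (ε / 6)
    (by positivity)
  obtain ⟨N', hN'⟩ := eventually_atTop.1 h2
  refine ⟨max N N', fun k hk => ?_⟩
  have h3 := hN k ((le_max_left _ _).trans hk)
  have h4 := hN _ (le_max_left N N')
  have h5 := hN' k ((le_max_right _ _).trans hk)
  have h6 := hN' _ (le_max_right N N')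
  simp only [Real.dist_eq, Function.comp_apply, abs_lt] at *
  constructor <;> linarith [h3.1, h3.2, h4.1, h4.2, h5.1, h5.2, h6.1, h6.2]

/-- Bounded sequences have weakly convergent subsequences. -/
theorem exists_weak_subseq [CompleteSpace (H 0)] [TopologicalSpace.SeparableSpace (H 0)]
    (hF : ∀ φ ∈ F, Tendsto (fun n => ‖φ n‖) atTop (𝓝 ‖φ 0‖))
    (hd : Dense ((fun φ : ∀ n, H n => φ 0) '' F))
    {σ : ℕ → ℕ} (hσ : IsSubseq σ) {φ : ∀ k, H (σ k)} (hφ : InFibres F σ φ) {M : ℝ}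
    (hM : ∀ k, ‖φ k‖ ≤ M) :
    ∃ τ : ℕ → ℕ, StrictMono τ ∧ ∃ f, Weak F (fun k => σ (τ k)) (fun k => φ (τ k)) f := by
  obtain ⟨τ, hτ, h⟩ := exists_subseq_tendsto_inner hF hd hσ hM
  choose S hS hS0 using exists_convSection hF hd
  choose L hL using fun f => h (S f) (hS f)
  have hτσ := (IsSubseq.comp hσ hτ).1.tendsto_atTop
  -- The limit depends on `ψ 0` only: two sections with equal value at `0` differ by a family whose
  -- norms tend to `0`. Hence `L` is a well-defined bounded linear functional on `H 0`, and Riesz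
  -- representation provides the weak limit.
  have key : ∀ ψ ∈ convSections F,
      Tendsto (fun k => inner ℝ (φ (τ k)) (ψ (σ (τ k)))) atTop (𝓝 (L (ψ 0))) := by
    intro ψ hψ
    have h1 := (tendsto_norm hF ((convSections F).sub_mem hψ (hS (ψ 0)))).comp hτσ
    simp only [Pi.sub_apply, hS0, sub_self, norm_zero] at h1
    have h2 : Tendsto (fun k => inner ℝ (φ (τ k)) (ψ (σ (τ k)) - S (ψ 0) (σ (τ k)))) atTop
        (𝓝 0) := by
      refine squeeze_zero_norm (fun k => (norm_inner_le_norm _ _).trans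
        (mul_le_mul_of_nonneg_right (hM (τ k)) (norm_nonneg _))) ?_
      simpa using h1.const_mul M
    simpa [inner_sub_right] using h2.add (hL (ψ 0))
  let L' : H 0 →ₗ[ℝ] ℝ :=
    { toFun := L
      map_add' := fun f g => by
        have h1 := key _ ((convSections F).add_mem (hS f) (hS g))
        simp only [Pi.add_apply, hS0, inner_add_right] at h1
        exact tendsto_nhds_unique h1 ((hL f).add (hL g))
      map_smul' := fun c f => by
        have h1 := key _ ((convSections F).smul_mem c (hS f))
        simp only [Pi.smul_apply, hS0, real_inner_smul_right] at h1
        exact tendsto_nhds_unique h1 ((hL f).const_mul c) }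
  have hL' : ∀ f, ‖L' f‖ ≤ M * ‖f‖ := by
    intro f
    have h1 := (tendsto_norm hF (hS f)).comp hτσ
    rw [hS0] at h1
    refine le_of_tendsto_of_tendsto' (hL f).norm (h1.const_mul M) fun k => ?_
    exact (norm_inner_le_norm _ _).trans
      (mul_le_mul_of_nonneg_right (hM (τ k)) (norm_nonneg _))
  refine ⟨τ, hτ, (InnerProductSpace.toDual ℝ (H 0)).symm (L'.mkContinuous M hL'),
    fun k => hφ _, fun ψ hψ => ?_⟩
  rw [InnerProductSpace.toDual_symm_apply]
  exact key ψ hψ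

/-- A bounded sequence with only one weak subsequential limit converges weakly. -/
theorem weak_of_subseq [CompleteSpace (H 0)] [TopologicalSpace.SeparableSpace (H 0)]
    (hF : ∀ φ ∈ F, Tendsto (fun n => ‖φ n‖) atTop (𝓝 ‖φ 0‖))
    (hd : Dense ((fun φ : ∀ n, H n => φ 0) '' F))
    {σ : ℕ → ℕ} (hσ : IsSubseq σ) {φ : ∀ k, H (σ k)} (hφ : InFibres F σ φ) {M : ℝ}
    (hM : ∀ k, ‖φ k‖ ≤ M) {f : H 0}
    (hf : ∀ τ : ℕ → ℕ, StrictMono τ → ∀ w,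
      Weak F (fun k => σ (τ k)) (fun k => φ (τ k)) w → w = f) :
    Weak F σ φ f := by
  -- It suffices that every subsequence has a further subsequence along which the pairings tend to
  -- the required limit.
  refine ⟨hφ, fun ψ hψ => tendsto_of_subseq_tendsto fun ns hns => ?_⟩
  obtain ⟨τ, hτ, hτ'⟩ := strictMono_subseq_of_tendsto_atTop hns
  obtain ⟨ρ, hρ, w, hw⟩ := exists_weak_subseq hF hd (IsSubseq.comp hσ hτ')
    (φ := fun k => φ (ns (τ k))) (fun k => hφ _) (fun k => hM _)
  obtain rfl := hf _ (hτ'.comp hρ) w hw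
  exact ⟨fun k => τ (ρ k), hw.2 ψ hψ⟩

end HilbertSeq

/-! ### Translation of `𝕄`-classes into families of `ν_n`-classes. -/

namespace MoscoSeq

variable {E : Type*} [MeasurableSpace E] {ν : ℕ → Measure E} {α : ℕ → ℝ≥0}

theorem absolutelyContinuous_mixture (hα : ∀ n, 0 < α n) (n : ℕ) : ν n ≪ mixture α ν := by
  refine Measure.AbsolutelyContinuous.mk fun s _ hs => ?_
  have h := Measure.le_iff'.1 (Measure.le_sum (fun n => α n • ν n) n) s
  rw [show Measure.sum (fun n => α n • ν n) s = 0 from hs, Measure.smul_apply] at h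
  simpa [ENNReal.smul_def, (hα n).ne'] using h

/-- A family of classes over measures with disjoint carriers comes from one class over the
mixture. -/
theorem exists_aeeq_fibres (hα : ∀ n, 0 < α n) (carrier : ℕ → Set E)
    (hcarrier_meas : ∀ n, MeasurableSet (carrier n))
    (hcarrier_disj : Pairwise fun m n => Disjoint (carrier m) (carrier n))
    (hcarrier : ∀ n, ν n (carrier n)ᶜ = 0) (s : ∀ n, Lp ℝ 2 (ν n)) :
    ∃ φ : E →ₘ[mixture α ν] ℝ, ∀ n, s n =ᵐ[ν n] φ := by
  obtain ⟨f, hf, hfs⟩ := exists_measurable_piecewise carrier hcarrier_meas (fun n => s n)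
    (fun n => (Lp.stronglyMeasurable (s n)).measurable) fun m n hmn x hx =>
      absurd hx.2 (Set.disjoint_left.1 (hcarrier_disj hmn) hx.1)
  refine ⟨AEEqFun.mk f hf.aestronglyMeasurable, fun n => ?_⟩
  have h1 := (absolutelyContinuous_mixture hα n).ae_eq
    (AEEqFun.coeFn_mk f (hf.aestronglyMeasurable (μ := mixture α ν)))
  have h2 : ∀ᵐ x ∂ν n, x ∈ carrier n := mem_ae_iff.2 (hcarrier n)
  filter_upwards [h1, h2] with x hx hxn
  rw [hx, hfs n hxn]

theorem pairing_eq_inner {n : ℕ} {φ ψ : E → ℝ} {u v : Lp ℝ 2 (ν n)} (hu : u =ᵐ[ν n] φ)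
    (hv : v =ᵐ[ν n] ψ) : pairing ν n φ ψ = inner ℝ u v := by
  rw [L2.inner_def]
  refine integral_congr_ae ?_
  filter_upwards [hu, hv] with x hx hx'
  simp [hx, hx', mul_comm]

/-- The families of `ν_n`-classes, `n ≥ 0`, of the elements of `F`. -/
def fibres (hα : ∀ n, 0 < α n) (F : Submodule ℝ (E →ₘ[mixture α ν] ℝ)) :
    Submodule ℝ (∀ n, Lp ℝ 2 (ν n)) where
  carrier := {s | ∃ φ ∈ F, ∀ n, s n =ᵐ[ν n] φ}
  zero_mem' := ⟨0, F.zero_mem, fun n => (Lp.coeFn_zero ℝ 2 (ν n)).trans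
    ((absolutelyContinuous_mixture hα n).ae_eq AEEqFun.coeFn_zero).symm⟩
  add_mem' := by
    rintro s t ⟨φ, hφ, hs⟩ ⟨ψ, hψ, ht⟩
    refine ⟨φ + ψ, F.add_mem hφ hψ, fun n => ?_⟩
    filter_upwards [hs n, ht n, Lp.coeFn_add (s n) (t n),
      (absolutelyContinuous_mixture hα n).ae_eq (AEEqFun.coeFn_add φ ψ)] with x h1 h2 h3 h4
    simp only [Pi.add_apply] at *
    rw [h3, h4, h1, h2]
  smul_mem' := by
    rintro c s ⟨φ, hφ, hs⟩
    refine ⟨c • φ, F.smul_mem c hφ, fun n => ?_⟩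
    filter_upwards [hs n, Lp.coeFn_smul c (s n),
      (absolutelyContinuous_mixture hα n).ae_eq (AEEqFun.coeFn_smul c φ)] with x h1 h2 h3
    simp only [Pi.smul_apply] at *
    rw [h2, h3, h1]

theorem exists_family {φ : E →ₘ[mixture α ν] ℝ} (hφ : φ ∈ classD α ν) :
    ∃ s : ∀ n, Lp ℝ 2 (ν n), ∀ n, s n =ᵐ[ν n] φ :=
  ⟨fun n => (hφ.1 n).toLp φ, fun _ => MemLp.coeFn_toLp _⟩

theorem mem_classD_iff {φ : E →ₘ[mixture α ν] ℝ} {s : ∀ n, Lp ℝ 2 (ν n)}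
    (hs : ∀ n, s n =ᵐ[ν n] φ) :
    φ ∈ classD α ν ↔ Tendsto (fun n => ‖s n‖) atTop (𝓝 ‖s 0‖) := by
  have h : ∀ n, pairing ν n φ φ = ‖s n‖ ^ 2 := fun n => by
    rw [pairing_eq_inner (hs n) (hs n), real_inner_self_eq_norm_sq]
  simp only [classD, Set.mem_ofPred_eq, h]
  refine ⟨fun h' => by simpa using h'.2.sqrt, fun h' => ⟨fun n => ?_, h'.pow 2⟩⟩
  exact (memLp_congr_ae (hs n)).1 (Lp.memLp (s n))

variable {F : Submodule ℝ (E →ₘ[mixture α ν] ℝ)}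

theorem tendsto_norm_fibres (hα : ∀ n, 0 < α n)
    (hF : (F : Set (E →ₘ[mixture α ν] ℝ)) ⊆ classD α ν) :
    ∀ s ∈ fibres hα F, Tendsto (fun n => ‖s n‖) atTop (𝓝 ‖s 0‖) := by
  rintro s ⟨φ, hφ, hs⟩
  exact (mem_classD_iff hs).1 (hF hφ)

theorem dense_fibres (hα : ∀ n, 0 < α n)
    (hF : (F : Set (E →ₘ[mixture α ν] ℝ)) ⊆ classD α ν)
    (hd : Dense (trace ν (F : Set (E →ₘ[mixture α ν] ℝ)) 0)) :
    Dense ((fun s : ∀ n, Lp ℝ 2 (ν n) => s 0) '' fibres hα F) := by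
  refine hd.mono ?_
  rintro u ⟨φ, hφ, hu⟩
  obtain ⟨s, hs⟩ := exists_family (hF hφ)
  exact ⟨s, ⟨φ, hφ, hs⟩, Lp.ext ((hs 0).trans hu.symm)⟩

theorem exists_fibres_iff (hα : ∀ n, 0 < α n)
    (hF : (F : Set (E →ₘ[mixture α ν] ℝ)) ⊆ classD α ν) {n : ℕ} {u : Lp ℝ 2 (ν n)} :
    (∃ s ∈ fibres hα F, u = s n) ↔ ∃ χ ∈ F, u =ᵐ[ν n] χ := by
  constructor
  · rintro ⟨s, ⟨φ, hφ, hs⟩, rfl⟩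
    exact ⟨φ, hφ, hs n⟩
  · rintro ⟨φ, hφ, hu⟩
    obtain ⟨s, hs⟩ := exists_family (hF hφ)
    exact ⟨s, ⟨φ, hφ, hs⟩, Lp.ext (hu.trans (hs n).symm)⟩

/-- Norm convergence and (c2) give the approximation by `F` through `mem_convSections_of_tendsto`;
conversely both are limits of norms and inner products of sections. -/
theorem mem_classC_iff (hα : ∀ n, 0 < α n)
    (hF : (F : Set (E →ₘ[mixture α ν] ℝ)) ⊆ classD α ν)
    (hd : Dense (trace ν (F : Set (E →ₘ[mixture α ν] ℝ)) 0))
    {φ : E →ₘ[mixture α ν] ℝ} {s : ∀ n, Lp ℝ 2 (ν n)} (hs : ∀ n, s n =ᵐ[ν n] φ) :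
    φ ∈ classC ν F ↔ s ∈ HilbertSeq.convSections (fibres hα F) := by
  have h1 : ∀ n, (∃ χ ∈ F, φ =ᵐ[ν n] χ) ↔ ∃ t ∈ fibres hα F, s n = t n := by
    intro n
    rw [exists_fibres_iff hα hF]
    exact ⟨fun ⟨χ, hχ, h⟩ => ⟨χ, hχ, (hs n).trans h⟩,
      fun ⟨χ, hχ, h⟩ => ⟨χ, hχ, (hs n).symm.trans h⟩⟩
  simp only [classC, Set.mem_ofPred_eq, h1]
  constructor
  · rintro ⟨hD, hc1, hc2⟩
    refine HilbertSeq.mem_convSections_of_tendsto (tendsto_norm_fibres hα hF)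
      (dense_fibres hα hF hd) hc1 ((mem_classD_iff hs).1 hD) ?_
    rintro t ⟨ψ, hψ, ht⟩
    simpa only [pairing_eq_inner (hs _) (ht _)] using hc2 ψ hψ
  · intro h
    refine ⟨(mem_classD_iff hs).2 (HilbertSeq.tendsto_norm (tendsto_norm_fibres hα hF) h), h.1,
      fun ψ hψ => ?_⟩
    obtain ⟨t, ht⟩ := exists_family (hF hψ)
    simp only [pairing_eq_inner (hs _) (ht _)]
    exact HilbertSeq.tendsto_inner (tendsto_norm_fibres hα hF) h
      (HilbertSeq.le_convSections ⟨ψ, hψ, ht⟩)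

theorem subset_classC (hα : ∀ n, 0 < α n)
    (hF : (F : Set (E →ₘ[mixture α ν] ℝ)) ⊆ classD α ν)
    (hd : Dense (trace ν (F : Set (E →ₘ[mixture α ν] ℝ)) 0)) :
    (F : Set (E →ₘ[mixture α ν] ℝ)) ⊆ classC ν F := by
  intro φ hφ
  obtain ⟨s, hs⟩ := exists_family (hF hφ)
  exact (mem_classC_iff hα hF hd hs).2 (HilbertSeq.le_convSections ⟨φ, hφ, hs⟩)

/-- For `n ≥ 1`, (c1) reduces the trace of `𝒞` to that of `F`; at `n = 0` no such condition is
imposed. -/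
theorem mem_trace_classC_iff (hα : ∀ n, 0 < α n)
    (hF : (F : Set (E →ₘ[mixture α ν] ℝ)) ⊆ classD α ν)
    (hd : Dense (trace ν (F : Set (E →ₘ[mixture α ν] ℝ)) 0)) {n : ℕ} (hn : 1 ≤ n)
    {u : Lp ℝ 2 (ν n)} : u ∈ trace ν (classC ν F) n ↔ ∃ s ∈ fibres hα F, u = s n := by
  rw [exists_fibres_iff hα hF]
  constructor
  · rintro ⟨φ, hφ, hu⟩
    obtain ⟨χ, hχ, h⟩ := hφ.2.1 n hn
    exact ⟨χ, hχ, hu.trans h⟩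
  · rintro ⟨χ, hχ, h⟩
    exact ⟨χ, subset_classC hα hF hd hχ, h⟩

/-- The disjoint carriers enter here: every section glues to an element of `𝒞`, so both notions have
the same test families. -/
theorem wConv_iff (hα : ∀ n, 0 < α n)
    (hF : (F : Set (E →ₘ[mixture α ν] ℝ)) ⊆ classD α ν)
    (hd : Dense (trace ν (F : Set (E →ₘ[mixture α ν] ℝ)) 0)) (carrier : ℕ → Set E)
    (hcarrier_meas : ∀ n, MeasurableSet (carrier n))
    (hcarrier_disj : Pairwise fun m n => Disjoint (carrier m) (carrier n))
    (hcarrier : ∀ n, ν n (carrier n)ᶜ = 0) {σ : ℕ → ℕ} (hσ : IsSubseq σ)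
    {φ : ∀ k, Lp ℝ 2 (ν (σ k))} {f : Lp ℝ 2 (ν 0)} :
    WConv F σ φ f ↔ HilbertSeq.Weak (fibres hα F) σ φ f := by
  refine and_congr (forall_congr' fun k => mem_trace_classC_iff hα hF hd (hσ.2 k)) ⟨?_, ?_⟩
  · intro h s hs
    obtain ⟨ψ, hψ⟩ := exists_aeeq_fibres hα carrier hcarrier_meas hcarrier_disj hcarrier s
    simpa only [pairing_eq_inner EventuallyEq.rfl (hψ _)] using
      h ψ ((mem_classC_iff hα hF hd hψ).2 hs)
  · intro h ψ hψ
    obtain ⟨s, hs⟩ := exists_family hψ.1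
    simpa only [pairing_eq_inner EventuallyEq.rfl (hs _)] using
      h s ((mem_classC_iff hα hF hd hs).1 hψ)

theorem sConv_iff (hα : ∀ n, 0 < α n)
    (hF : (F : Set (E →ₘ[mixture α ν] ℝ)) ⊆ classD α ν)
    (hd : Dense (trace ν (F : Set (E →ₘ[mixture α ν] ℝ)) 0)) (carrier : ℕ → Set E)
    (hcarrier_meas : ∀ n, MeasurableSet (carrier n))
    (hcarrier_disj : Pairwise fun m n => Disjoint (carrier m) (carrier n))
    (hcarrier : ∀ n, ν n (carrier n)ᶜ = 0) {σ : ℕ → ℕ} (hσ : IsSubseq σ)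
    {φ : ∀ k, Lp ℝ 2 (ν (σ k))} {f : Lp ℝ 2 (ν 0)} :
    SConv F σ φ f ↔ HilbertSeq.Strong (fibres hα F) σ φ f := by
  refine and_congr
    (wConv_iff hα hF hd carrier hcarrier_meas hcarrier_disj hcarrier hσ) ?_
  simp only [real_inner_self_eq_norm_sq]
  exact ⟨fun h => by simpa using h.sqrt, fun h => h.pow 2⟩

end MoscoSeq

/-! ### Bilinearity and coercivity of the shifted form. -/

namespace ContractionSemigroup

variable {H : Type*} [NormedAddCommGroup H] [InnerProductSpace ℝ H] {T : ContractionSemigroup H}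
  {β : ℝ} {u v w : H}

theorem formShift_add_left (hu : u ∈ T.domain) (hv : v ∈ T.domain) :
    T.formShift β (u + v) w = T.formShift β u w + T.formShift β v w := by
  simp only [formShift, form, generator_add hu hv, inner_add_left]
  ring

theorem formShift_sub_left (hu : u ∈ T.domain) (hv : v ∈ T.domain) :
    T.formShift β (u - v) w = T.formShift β u w - T.formShift β v w := by
  simp only [formShift, form, generator_sub hu hv, inner_sub_left]
  ring

theorem formShift_smul_left (c : ℝ) (hu : u ∈ T.domain) :
    T.formShift β (c • u) w = c * T.formShift β u w := by
  simp only [formShift, form, generator_smul c hu, real_inner_smul_left]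
  ring

theorem formShift_add_right : T.formShift β u (v + w) = T.formShift β u v + T.formShift β u w := by
  simp only [formShift, form, inner_add_right]
  ring

theorem formShift_sub_right : T.formShift β u (v - w) = T.formShift β u v - T.formShift β u w := by
  simp only [formShift, form, inner_sub_right]
  ring

theorem formShift_smul_right (c : ℝ) : T.formShift β u (c • v) = c * T.formShift β u v := by
  simp only [formShift, form, real_inner_smul_right]
  ring

theorem formShift_self : T.formShift β u u = β * ‖u‖ ^ 2 + T.form u u := by
  rw [formShift, real_inner_self_eq_norm_sq]

theorem mul_norm_sq_le_formShift_self (hu : u ∈ T.domain) :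
    β * ‖u‖ ^ 2 ≤ T.formShift β u u := by
  rw [formShift_self]
  exact le_add_of_nonneg_right (form_self_nonneg hu)

end ContractionSemigroup

/-! ### Convergence of the resolvents under Mosco-type convergence. -/

namespace HilbertSeq

open MoscoSeq (IsSubseq)

variable {H : ℕ → Type*} [∀ n, NormedAddCommGroup (H n)] [∀ n, InnerProductSpace ℝ (H n)]

/-- The generators are bounded along a sequence. -/
def BddGenerators (T : ∀ n, ContractionSemigroup (H n)) (σ : ℕ → ℕ) (u : ∀ k, H (σ k)) : Prop :=
  ∃ M, ∀ k, ‖(T (σ k)).generator (u k)‖ ≤ M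

/-- `ψs` is a recovery sequence for `ψ`. -/
structure IsRecovery (F : Submodule ℝ (∀ n, H n)) (T : ∀ n, ContractionSemigroup (H n))
    (σ : ℕ → ℕ) (ψs : ∀ k, H (σ k)) (ψ : H 0) : Prop where
  mem_domain : ∀ k, ψs k ∈ (T (σ k)).domain
  strong : Strong F σ ψs ψ
  bdd : BddGenerators T σ ψs
  limsup_le : limsup (fun k => (((T (σ k)).form (ψs k) (ψs k) : ℝ) : EReal)) atTop
    ≤ (((T 0).form ψ ψ : ℝ) : EReal)

/-- Mosco-type convergence of the forms, together with the stability of the fibres of `F` under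
the resolvents and the standing assumptions on `F`. -/
structure MoscoConverge (F : Submodule ℝ (∀ n, H n)) (T : ∀ n, ContractionSemigroup (H n))
    [∀ n, CompleteSpace (H n)] : Prop where
  tendsto_norm : ∀ φ ∈ F, Tendsto (fun n => ‖φ n‖) atTop (𝓝 ‖φ 0‖)
  dense : Dense ((fun φ : ∀ n, H n => φ 0) '' F)
  resolvent_mem : ∀ β : ℝ, 0 < β → ∀ n, 1 ≤ n → ∀ g, (∃ χ ∈ F, g = χ n) →
    ∃ χ ∈ F, (T n).resolvent β g = χ n
  dual_resolvent_mem : ∀ β : ℝ, 0 < β → ∀ n, 1 ≤ n → ∀ g, (∃ χ ∈ F, g = χ n) →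
    ∃ χ ∈ F, (T n).dual.resolvent β g = χ n
  lowerBound : ∀ σ : ℕ → ℕ, IsSubseq σ → ∀ (φs : ∀ k, H (σ k)) (φ : H 0),
    (∀ k, φs k ∈ (T (σ k)).domain) → Weak F σ φs φ → BddGenerators T σ φs →
    φ ∈ (T 0).domain ∧ (((T 0).form φ φ : ℝ) : EReal) ≤
      liminf (fun k => (((T (σ k)).form (φs k) (φs k) : ℝ) : EReal)) atTop
  hasRecovery : ∀ ψ ∈ (T 0).domain, ∃ ψs : ∀ k, H (k + 1), IsRecovery F T (fun k => k + 1) ψs ψ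
  formDuality : ∀ β : ℝ, 0 < β → ∀ σ : ℕ → ℕ, IsSubseq σ → ∀ (us : ∀ k, H (σ k)) (u : H 0),
    (∀ k, us k ∈ (T (σ k)).domain) → InFibres F σ (fun k => (T (σ k)).generator (us k)) →
    (∃ w, Weak F σ us w) → BddGenerators T σ us → u ∈ (T 0).domain →
    (∀ (ψs : ∀ k, H (σ k)) (ψ : H 0), Strong F σ ψs ψ →
      Tendsto (fun k => (T (σ k)).formShift β (us k) (ψs k)) atTop
        (𝓝 ((T 0).formShift β u ψ))) →
    ∀ (ψs : ∀ k, H (σ k)) (ψ : H 0), ψ ∈ (T 0).domain → IsRecovery F T σ ψs ψ →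
      Tendsto (fun k => (T (σ k)).formShift β (ψs k) (us k)) atTop (𝓝 ((T 0).formShift β ψ u))

variable {F : Submodule ℝ (∀ n, H n)} {T : ∀ n, ContractionSemigroup (H n)}

theorem limsup_subseq_le {a : ℕ → EReal} {τ : ℕ → ℕ} (hτ : StrictMono τ) :
    limsup (fun k => a (τ k)) atTop ≤ limsup a atTop :=
  limsup_le_limsup_of_le (f := map τ atTop) (g := atTop) hτ.tendsto_atTop

theorem IsRecovery.comp {σ τ : ℕ → ℕ} {ψs : ∀ k, H (σ k)} {ψ : H 0}
    (h : IsRecovery F T σ ψs ψ) (hτ : StrictMono τ) :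
    IsRecovery F T (fun k => σ (τ k)) (fun k => ψs (τ k)) ψ where
  mem_domain _ := h.mem_domain _
  strong := h.strong.comp hτ
  bdd := h.bdd.imp fun _ hM _ => hM _
  limsup_le := (limsup_subseq_le
    (a := fun k => (((T (σ k)).form (ψs k) (ψs k) : ℝ) : EReal)) hτ).trans h.limsup_le

theorem BddGenerators.sub {σ : ℕ → ℕ} {u v : ∀ k, H (σ k)} (hu : ∀ k, u k ∈ (T (σ k)).domain)
    (hv : ∀ k, v k ∈ (T (σ k)).domain) (hu' : BddGenerators T σ u) (hv' : BddGenerators T σ v) :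
    BddGenerators T σ fun k => u k - v k := by
  obtain ⟨M, hM⟩ := hu'
  obtain ⟨M', hM'⟩ := hv'
  refine ⟨M + M', fun k => ?_⟩
  rw [ContractionSemigroup.generator_sub (hu k) (hv k)]
  exact (norm_sub_le _ _).trans (add_le_add (hM k) (hM' k))

variable [∀ n, CompleteSpace (H n)]

namespace MoscoConverge

/-- The limsup bound of a recovery sequence meets the liminf bound of (i). -/
theorem tendsto_form (h : MoscoConverge F T) {σ : ℕ → ℕ} (hσ : IsSubseq σ) {ψs : ∀ k, H (σ k)}
    {ψ : H 0} (hψ : IsRecovery F T σ ψs ψ) :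
    Tendsto (fun k => (T (σ k)).form (ψs k) (ψs k)) atTop (𝓝 ((T 0).form ψ ψ)) :=
  EReal.tendsto_coe.1 <| tendsto_of_le_liminf_of_limsup_le
    (h.lowerBound σ hσ ψs ψ hψ.mem_domain hψ.strong.1 hψ.bdd).2 hψ.limsup_le

theorem tendsto_formShift (h : MoscoConverge F T) (β : ℝ) {σ : ℕ → ℕ} (hσ : IsSubseq σ)
    {ψs : ∀ k, H (σ k)} {ψ : H 0} (hψ : IsRecovery F T σ ψs ψ) :
    Tendsto (fun k => (T (σ k)).formShift β (ψs k) (ψs k)) atTop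
      (𝓝 ((T 0).formShift β ψ ψ)) := by
  simp only [ContractionSemigroup.formShift_self]
  exact ((hψ.strong.2.pow 2).const_mul β).add (h.tendsto_form hσ hψ)

/-- Lower semicontinuity of the shifted forms along weakly convergent sequences. -/
theorem formShift_le (h : MoscoConverge F T) {β : ℝ} (hβ : 0 < β) {σ : ℕ → ℕ} (hσ : IsSubseq σ)
    {ds : ∀ k, H (σ k)} {d : H 0} (hds : ∀ k, ds k ∈ (T (σ k)).domain) (hd : Weak F σ ds d)
    (hb : BddGenerators T σ ds) {c : ℝ}
    (hc : Tendsto (fun k => (T (σ k)).formShift β (ds k) (ds k)) atTop (𝓝 c)) :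
    (T 0).formShift β d d ≤ c := by
  obtain ⟨χ, hχ, rfl⟩ := exists_convSection h.tendsto_norm h.dense d
  have h1 := (HilbertSeq.tendsto_norm h.tendsto_norm hχ).comp hσ.1.tendsto_atTop
  -- The term `β ‖d_n‖²` is bounded below by `2β ⟨d_n, χ_n⟩ - β ‖χ_n‖²`, which converges to `β
  -- ‖d‖²`. This gives an upper bound for `S_n(d_n, d_n)` with a limit, to be compared with (i).
  have h2 := hc.sub (((hd.2 χ hχ).const_mul (2 * β)).sub ((h1.pow 2).const_mul β))
  have h3 := (h.lowerBound σ hσ ds _ hds hd hb).2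
  have h4 : liminf (fun k => (((T (σ k)).form (ds k) (ds k) : ℝ) : EReal)) atTop ≤ _ :=
    (liminf_le_liminf (Eventually.of_forall fun k => EReal.coe_le_coe_iff.2 ?_)).trans_eq
      (EReal.tendsto_coe.2 h2).liminf_eq
  · have h5 := EReal.coe_le_coe_iff.1 (h3.trans h4)
    rw [real_inner_self_eq_norm_sq] at h5
    rw [ContractionSemigroup.formShift_self]
    linarith
  · have h5 := norm_sub_sq_real (ds k) (χ (σ k))
    have h6 := mul_nonneg hβ.le (sq_nonneg ‖ds k - χ (σ k)‖)
    rw [h5] at h6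
    simp only [ContractionSemigroup.formShift_self, Function.comp_apply]
    linarith

variable {β : ℝ}

theorem inFibres_resolvent (h : MoscoConverge F T) (hβ : 0 < β) {σ : ℕ → ℕ} (hσ : IsSubseq σ)
    {fs : ∀ k, H (σ k)} (hfs : InFibres F σ fs) :
    InFibres F σ fun k => (T (σ k)).resolvent β (fs k) :=
  fun k => h.resolvent_mem β hβ _ (hσ.2 k) _ (hfs k)

theorem inFibres_dual_resolvent (h : MoscoConverge F T) (hβ : 0 < β) {σ : ℕ → ℕ}
    (hσ : IsSubseq σ) {fs : ∀ k, H (σ k)} (hfs : InFibres F σ fs) :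
    InFibres F σ fun k => (T (σ k)).dual.resolvent β (fs k) :=
  fun k => h.dual_resolvent_mem β hβ _ (hσ.2 k) _ (hfs k)

theorem exists_norm_resolvent_le (h : MoscoConverge F T) (hβ : 0 < β) {σ : ℕ → ℕ}
    (hσ : IsSubseq σ) {fs : ∀ k, H (σ k)} {f : H 0} (hf : Weak F σ fs f) :
    ∃ M, ∀ k, ‖(T (σ k)).resolvent β (fs k)‖ ≤ M := by
  obtain ⟨M, hM⟩ := hf.exists_norm_le h.tendsto_norm h.dense hσ
  exact ⟨β⁻¹ * M, fun k => ((T (σ k)).norm_resolvent_le hβ (fs k)).trans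
    (mul_le_mul_of_nonneg_left (hM k) (inv_nonneg.2 hβ.le))⟩

theorem bddGenerators_resolvent (h : MoscoConverge F T) (hβ : 0 < β) {σ : ℕ → ℕ}
    (hσ : IsSubseq σ) {fs : ∀ k, H (σ k)} {f : H 0} (hf : Weak F σ fs f) :
    BddGenerators T σ fun k => (T (σ k)).resolvent β (fs k) := by
  obtain ⟨M, hM⟩ := hf.exists_norm_le h.tendsto_norm h.dense hσ
  obtain ⟨M', hM'⟩ := h.exists_norm_resolvent_le hβ hσ hf
  refine ⟨β * M' + M, fun k => ?_⟩
  rw [(T (σ k)).generator_resolvent hβ]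
  refine (norm_sub_le _ _).trans (add_le_add ?_ (hM k))
  rw [norm_smul, Real.norm_of_nonneg hβ.le]
  exact mul_le_mul_of_nonneg_left (hM' k) hβ.le

/-- The duality condition applied to resolvents of a weakly convergent sequence. -/
theorem tendsto_formShift_resolvent (h : MoscoConverge F T) (hβ : 0 < β) {σ : ℕ → ℕ}
    (hσ : IsSubseq σ) {fs : ∀ k, H (σ k)} {f : H 0} (hf : Weak F σ fs f)
    (hw : ∃ w, Weak F σ (fun k => (T (σ k)).resolvent β (fs k)) w)
    {ψs : ∀ k, H (σ k)} {ψ : H 0} (hψ : ψ ∈ (T 0).domain) (hψs : IsRecovery F T σ ψs ψ) :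
    Tendsto (fun k => (T (σ k)).formShift β (ψs k) ((T (σ k)).resolvent β (fs k))) atTop
      (𝓝 ((T 0).formShift β ψ ((T 0).resolvent β f))) := by
  -- The element `u` of the duality condition is taken to be `G_β f`; it is not required to be the
  -- weak limit of the resolvents.
  refine h.formDuality β hβ σ hσ _ _ (fun k => (T (σ k)).resolvent_mem_domain hβ _) ?_ hw
    (h.bddGenerators_resolvent hβ hσ hf) ((T 0).resolvent_mem_domain hβ f) ?_ ψs ψ hψ hψs
  · simp only [(T _).generator_resolvent hβ]
    exact ((h.inFibres_resolvent hβ hσ hf.1).smul fun _ => β).sub hf.1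
  · intro χs χ hχ
    simp only [(T _).formShift_resolvent hβ]
    exact hf.tendsto_inner h.tendsto_norm h.dense hσ hχ

/-- The shifted form at the difference of the resolvents and a recovery sequence. -/
theorem tendsto_formShift_sub (h : MoscoConverge F T) (hβ : 0 < β) {σ : ℕ → ℕ}
    (hσ : IsSubseq σ) {fs : ∀ k, H (σ k)} {f w : H 0} (hf : Strong F σ fs f)
    (hw : Weak F σ (fun k => (T (σ k)).resolvent β (fs k)) w)
    {ψs : ∀ k, H (σ k)} {ψ : H 0} (hψ : ψ ∈ (T 0).domain) (hψs : IsRecovery F T σ ψs ψ) :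
    Tendsto (fun k => (T (σ k)).formShift β ((T (σ k)).resolvent β (fs k) - ψs k)
        ((T (σ k)).resolvent β (fs k) - ψs k)) atTop
      (𝓝 (inner ℝ f (w - ψ) - ((T 0).formShift β ψ ((T 0).resolvent β f) -
        (T 0).formShift β ψ ψ))) := by
  have h1 := (hw.sub hψs.strong.1).tendsto_inner h.tendsto_norm h.dense hσ hf
  rw [real_inner_comm] at h1
  refine (h1.sub ((h.tendsto_formShift_resolvent hβ hσ hf.1 ⟨w, hw⟩ hψ hψs).sub
    (h.tendsto_formShift β hσ hψs))).congr fun k => ?_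
  rw [ContractionSemigroup.formShift_sub_left ((T (σ k)).resolvent_mem_domain hβ _)
    (hψs.mem_domain k), (T (σ k)).formShift_resolvent hβ,
    ContractionSemigroup.formShift_sub_right (u := ψs k), real_inner_comm]

/-- A weak limit of resolvents of a strongly convergent sequence is the resolvent of the limit. -/
theorem eq_resolvent_of_weak (h : MoscoConverge F T) (hβ : 0 < β) {τ : ℕ → ℕ}
    (hτ : StrictMono τ) {fs : ∀ k, H (τ k + 1)} {f w : H 0}
    (hf : Strong F (fun k => τ k + 1) fs f)
    (hw : Weak F (fun k => τ k + 1) (fun k => (T (τ k + 1)).resolvent β (fs k)) w) :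
    w = (T 0).resolvent β f := by
  have hσ : IsSubseq fun k => τ k + 1 := IsSubseq.comp isSubseq_succ hτ
  set G := (T 0).resolvent β f with hG
  have hGd : G ∈ (T 0).domain := (T 0).resolvent_mem_domain hβ f
  have hud := fun k => (T (τ k + 1)).resolvent_mem_domain hβ (fs k)
  have hub := h.bddGenerators_resolvent hβ hσ hf.1
  have hwd : w ∈ (T 0).domain := (h.lowerBound _ hσ _ w hud hw hub).1
  have key : ∀ ψ ∈ (T 0).domain, (T 0).formShift β (w - ψ) (w - ψ) ≤
      inner ℝ f (w - ψ) - ((T 0).formShift β ψ G - (T 0).formShift β ψ ψ) := by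
    intro ψ hψ
    obtain ⟨ψs, hψs⟩ := h.hasRecovery ψ hψ
    have hψτ := hψs.comp hτ
    exact h.formShift_le hβ hσ
      (fun k => ContractionSemigroup.sub_mem_domain (hud k) (hψτ.mem_domain k))
      (hw.sub hψτ.strong.1) (BddGenerators.sub hud hψτ.mem_domain hub hψτ.bdd)
      (h.tendsto_formShift_sub hβ hσ hf hw hψ hψτ)
  have hηd := ContractionSemigroup.sub_mem_domain hwd hGd
  set η := w - G with hη
  -- With `ψ = w + ε η` the terms `ε² S_β(η, η)` on both sides of `key` cancel, leaving an
  -- expression affine in `ε`.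
  have h1 : ∀ ε : ℝ, 0 ≤ (T 0).formShift β w η + 2 * ε * (T 0).formShift β η η := by
    intro ε
    have h2 := key (w + ε • η)
      (ContractionSemigroup.add_mem_domain hwd (ContractionSemigroup.smul_mem_domain ε hηd))
    have h3 : w - (w + ε • η) = (-ε) • η := by
      rw [neg_smul]
      abel
    have hεη := ContractionSemigroup.smul_mem_domain ε hηd
    rw [h3, ← (T 0).formShift_resolvent hβ, ← hG,
      ContractionSemigroup.formShift_smul_left _ hηd,
      ContractionSemigroup.formShift_add_left hwd hεη,
      ContractionSemigroup.formShift_add_left hwd hεη,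
      ContractionSemigroup.formShift_smul_left _ hηd,
      ContractionSemigroup.formShift_smul_left _ hηd] at h2
    simp only [ContractionSemigroup.formShift_add_right,
      ContractionSemigroup.formShift_smul_right] at h2
    have h4 : (T 0).formShift β w η = (T 0).formShift β w w - (T 0).formShift β w G :=
      ContractionSemigroup.formShift_sub_right
    have h5 : (T 0).formShift β η η = (T 0).formShift β η w - (T 0).formShift β η G :=
      ContractionSemigroup.formShift_sub_right
    have h6 : (T 0).formShift β η η = (T 0).formShift β w η - (T 0).formShift β G η :=
      ContractionSemigroup.formShift_sub_left hwd hGd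
    have h7 : ε * (T 0).formShift β η η = ε * (T 0).formShift β η w -
        ε * (T 0).formShift β η G := by rw [h5]; ring
    have h8 : ε * (T 0).formShift β η η = ε * (T 0).formShift β w η -
        ε * (T 0).formShift β G η := by rw [h6]; ring
    linarith
  have h2 := ContractionSemigroup.mul_norm_sq_le_formShift_self (β := β) hηd
  have h3 : (T 0).formShift β η η = 0 := by
    by_contra hne
    -- This `ε` gives the affine expression the value `-1`.
    have h4 := h1 (-((T 0).formShift β w η + 1) / (2 * (T 0).formShift β η η))
    have h5 : 2 * (-((T 0).formShift β w η + 1) / (2 * (T 0).formShift β η η)) *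
        (T 0).formShift β η η = -((T 0).formShift β w η + 1) := by
      field_simp
    linarith
  have h4 : ‖η‖ ^ 2 ≤ 0 := by nlinarith [sq_nonneg ‖η‖]
  exact sub_eq_zero.1 (norm_eq_zero.1 (pow_eq_zero_iff two_ne_zero |>.1
    (le_antisymm h4 (sq_nonneg _))))

variable [TopologicalSpace.SeparableSpace (H 0)]

/-- Weak convergence follows from compactness and uniqueness of the limit. For a recovery sequence
`ψ_n` of `G_β f`, coercivity bounds `β ‖u_n - ψ_n‖²` by a form value tending to `0`, so the
resolvents `u_n` inherit strong convergence from `ψ_n`. -/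
theorem strong_resolvent (h : MoscoConverge F T) (hβ : 0 < β) {fs : ∀ k, H (k + 1)} {f : H 0}
    (hf : Strong F (fun k => k + 1) fs f) :
    Strong F (fun k => k + 1) (fun k => (T (k + 1)).resolvent β (fs k))
      ((T 0).resolvent β f) := by
  have hfib := h.inFibres_resolvent hβ isSubseq_succ hf.1.1
  obtain ⟨M, hM⟩ := h.exists_norm_resolvent_le hβ isSubseq_succ hf.1
  have hw : Weak F (fun k => k + 1) (fun k => (T (k + 1)).resolvent β (fs k))
      ((T 0).resolvent β f) :=
    weak_of_subseq h.tendsto_norm h.dense isSubseq_succ hfib hM fun τ hτ w hw =>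
      h.eq_resolvent_of_weak hβ hτ (hf.comp hτ) hw
  have hGd := (T 0).resolvent_mem_domain hβ f
  obtain ⟨ψs, hψs⟩ := h.hasRecovery _ hGd
  refine Strong.of_norm_sub h.tendsto_norm hfib hψs.strong isSubseq_succ ?_
  have h1 := h.tendsto_formShift_sub hβ isSubseq_succ hf hw hGd hψs
  simp only [sub_self, inner_zero_right] at h1
  have h2 : Tendsto (fun k => ‖(T (k + 1)).resolvent β (fs k) - ψs k‖ ^ 2) atTop (𝓝 0) := by
    refine squeeze_zero (fun k => sq_nonneg _) (fun k => ?_)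
      (by simpa using h1.const_mul β⁻¹)
    rw [← div_eq_inv_mul, le_div_iff₀ hβ, mul_comm]
    exact ContractionSemigroup.mul_norm_sq_le_formShift_self
      (ContractionSemigroup.sub_mem_domain ((T (k + 1)).resolvent_mem_domain hβ _)
        (hψs.mem_domain k))
  simpa using h2.sqrt

/-- The form at a resolvent is `⟨g, G_β g⟩ - β ‖G_β g‖²`, which converges once the resolvents
converge strongly. -/
theorem isRecovery_resolvent (h : MoscoConverge F T) (hβ : 0 < β) {fs : ∀ k, H (k + 1)}
    {f : H 0} (hf : Strong F (fun k => k + 1) fs f) :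
    IsRecovery F T (fun k => k + 1) (fun k => (T (k + 1)).resolvent β (fs k))
      ((T 0).resolvent β f) where
  mem_domain k := (T (k + 1)).resolvent_mem_domain hβ _
  strong := h.strong_resolvent hβ hf
  bdd := h.bddGenerators_resolvent hβ isSubseq_succ hf.1
  limsup_le := by
    have hs := h.strong_resolvent hβ hf
    have key : ∀ n (g : H n), (T n).form ((T n).resolvent β g) ((T n).resolvent β g) =
        inner ℝ g ((T n).resolvent β g) - β * ‖(T n).resolvent β g‖ ^ 2 := fun n g => by
      rw [← (T n).formShift_resolvent hβ, ContractionSemigroup.formShift_self]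
      ring
    simp only [key]
    exact (EReal.tendsto_coe.2 ((hf.1.tendsto_inner h.tendsto_norm h.dense isSubseq_succ hs).sub
      ((hs.2.pow 2).const_mul β))).limsup_eq.le

/-- Moving `G'` onto the test section makes it a strongly convergent resolvent, paired with a weakly
convergent sequence. -/
theorem weak_dual_resolvent (h : MoscoConverge F T) (hβ : 0 < β) {fs : ∀ k, H (k + 1)} {f : H 0}
    (hf : Weak F (fun k => k + 1) fs f) :
    Weak F (fun k => k + 1) (fun k => (T (k + 1)).dual.resolvent β (fs k))
      ((T 0).dual.resolvent β f) := by
  refine ⟨h.inFibres_dual_resolvent hβ isSubseq_succ hf.1, fun ψ hψ => ?_⟩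
  simp only [(T _).inner_dual_resolvent hβ]
  exact hf.tendsto_inner h.tendsto_norm h.dense isSubseq_succ
    (h.strong_resolvent hβ (strong_of_mem h.tendsto_norm hψ isSubseq_succ))

theorem weak_resolvent (h : MoscoConverge F T) (hβ : 0 < β) {fs : ∀ k, H (k + 1)} {f : H 0}
    (hf : Weak F (fun k => k + 1) fs f) :
    Weak F (fun k => k + 1) (fun k => (T (k + 1)).resolvent β (fs k))
      ((T 0).resolvent β f) := by
  obtain ⟨M, hM⟩ := h.exists_norm_resolvent_le hβ isSubseq_succ hf
  refine weak_of_subseq h.tendsto_norm h.dense isSubseq_succ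
    (h.inFibres_resolvent hβ isSubseq_succ hf.1) hM fun τ hτ w hw => ext_inner_right ℝ fun g => ?_
  obtain ⟨s, hs, rfl⟩ := exists_convSection h.tendsto_norm h.dense g
  have hss := strong_of_mem h.tendsto_norm hs isSubseq_succ
  -- The resolvents of the test section `s` serve as recovery sequence. As `S_{n,β}(G_{n,β} s_n, ·)
  -- = ⟨s_n, ·⟩`, duality identifies the limit of `⟨s_n, G_{n,β} f_n⟩`.
  have h1 := h.tendsto_formShift_resolvent hβ (IsSubseq.comp isSubseq_succ hτ) (hf.comp hτ)
    ⟨w, hw⟩ ((T 0).resolvent_mem_domain hβ _) ((h.isRecovery_resolvent hβ hss).comp hτ)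
  simp only [(T _).formShift_resolvent hβ] at h1
  have h2 := hw.2 s hs
  simp only [real_inner_comm (s _)] at h2
  rw [real_inner_comm]
  exact tendsto_nhds_unique h2 (by simpa only [real_inner_comm] using h1)

/-- Norms converge because `‖G' g‖² = ⟨G G' g, g⟩`: here `G G' g_n` converges weakly by the two weak
statements, and `g_n` strongly. -/
theorem strong_dual_resolvent (h : MoscoConverge F T) (hβ : 0 < β) {fs : ∀ k, H (k + 1)}
    {f : H 0} (hf : Strong F (fun k => k + 1) fs f) :
    Strong F (fun k => k + 1) (fun k => (T (k + 1)).dual.resolvent β (fs k))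
      ((T 0).dual.resolvent β f) := by
  have hw := h.weak_dual_resolvent hβ hf.1
  refine ⟨hw, ?_⟩
  have h1 := (h.weak_resolvent hβ hw).tendsto_inner h.tendsto_norm h.dense isSubseq_succ hf
  have key : ∀ n (g : H n), inner ℝ ((T n).resolvent β ((T n).dual.resolvent β g)) g =
      ‖(T n).dual.resolvent β g‖ ^ 2 := fun n g => by
    rw [real_inner_comm, ← (T n).inner_dual_resolvent hβ, real_inner_self_eq_norm_sq]
  simp only [key] at h1
  simpa using h1.sqrt

end MoscoConverge
end HilbertSeq

/-! ### Return to the measures `ν_n` and the theorem. -/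

namespace MoscoSeq

variable {E : Type*} [MeasurableSpace E] {ν : ℕ → Measure E} {α : ℕ → ℝ≥0}

theorem bddGenerators_iff {T : ∀ n, ContractionSemigroup (Lp ℝ 2 (ν n))} {σ : ℕ → ℕ}
    {u : ∀ k, Lp ℝ 2 (ν (σ k))} : BddGenerators T σ u ↔ HilbertSeq.BddGenerators T σ u := by
  simp only [BddGenerators, HilbertSeq.BddGenerators, bddAbove_def, Set.forall_mem_range,
    real_inner_self_eq_norm_sq]
  constructor
  · rintro ⟨M, hM⟩
    exact ⟨√M, fun k => Real.le_sqrt_of_sq_le (hM k)⟩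
  · rintro ⟨M, hM⟩
    exact ⟨M ^ 2, fun k => pow_le_pow_left₀ (norm_nonneg _) (hM k) 2⟩

/-- Convergence of the forms, expressed through the families of `ν_n`-classes. -/
theorem FormsConverge.moscoConverge {F : Submodule ℝ (E →ₘ[mixture α ν] ℝ)}
    {T : ∀ n, ContractionSemigroup (Lp ℝ 2 (ν n))} (hα : ∀ n, 0 < α n)
    (hF : (F : Set (E →ₘ[mixture α ν] ℝ)) ⊆ classD α ν)
    (hd : Dense (trace ν (F : Set (E →ₘ[mixture α ν] ℝ)) 0)) (carrier : ℕ → Set E)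
    (hcarrier_meas : ∀ n, MeasurableSet (carrier n))
    (hcarrier_disj : Pairwise fun m n => Disjoint (carrier m) (carrier n))
    (hcarrier : ∀ n, ν n (carrier n)ᶜ = 0) (hstable : ResolventStable F T)
    (hconv : FormsConverge F T) : HilbertSeq.MoscoConverge (fibres hα F) T := by
  have hW : ∀ {σ : ℕ → ℕ}, IsSubseq σ → ∀ {φ : ∀ k, Lp ℝ 2 (ν (σ k))} {f : Lp ℝ 2 (ν 0)},
      WConv F σ φ f ↔ HilbertSeq.Weak (fibres hα F) σ φ f := fun hσ =>
    wConv_iff hα hF hd carrier hcarrier_meas hcarrier_disj hcarrier hσ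
  have hS : ∀ {σ : ℕ → ℕ}, IsSubseq σ → ∀ {φ : ∀ k, Lp ℝ 2 (ν (σ k))} {f : Lp ℝ 2 (ν 0)},
      SConv F σ φ f ↔ HilbertSeq.Strong (fibres hα F) σ φ f := fun hσ =>
    sConv_iff hα hF hd carrier hcarrier_meas hcarrier_disj hcarrier hσ
  refine ⟨tendsto_norm_fibres hα hF, dense_fibres hα hF hd, fun β hβ n hn g hg => ?_,
    fun β hβ n hn g hg => ?_, fun σ hσ φs φ h1 h2 h3 => ?_, fun ψ hψ => ?_,
    fun β hβ σ hσ us u h1 h2 h3 h4 h5 h6 ψs ψ hψ hr => ?_⟩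
  · rw [← mem_trace_classC_iff hα hF hd hn] at hg ⊢
    exact (hstable n β hβ g hg).1
  · rw [← mem_trace_classC_iff hα hF hd hn] at hg ⊢
    exact (hstable n β hβ g hg).2
  · exact hconv.lowerBound σ hσ φs φ h1 ((hW hσ).2 h2) (bddGenerators_iff.2 h3)
  · obtain ⟨ψs, h1, h2, h3, h4⟩ := hconv.hasRecovery ψ hψ
    exact ⟨ψs, h1, (hS HilbertSeq.isSubseq_succ).1 h2, bddGenerators_iff.1 h3, h4⟩
  · exact hconv.formDuality β hβ σ hσ us u h1
      (fun k => (mem_trace_classC_iff hα hF hd (hσ.2 k)).2 (h2 k))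
      (h3.imp fun w hw => (hW hσ).2 hw) (bddGenerators_iff.2 h4) h5
      (fun χs χ _ hχ => h6 χs χ ((hS hσ).1 hχ)) ψs ψ hψ
      ⟨hr.mem_domain, (hS hσ).2 hr.strong, bddGenerators_iff.2 hr.bdd, hr.limsup_le⟩

end MoscoSeq

theorem theorem2p7 {E : Type*} [MeasurableSpace E]
    (ν : ℕ → Measure E) [∀ n, IsProbabilityMeasure (ν n)] (hsep : MeasureTheory.IsSeparable (ν 0))
    (carrier : ℕ → Set E) (hcarrier_meas : ∀ n, MeasurableSet (carrier n))
    (hcarrier_disj : Pairwise fun m n => Disjoint (carrier m) (carrier n))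
    (hcarrier : ∀ n, ν n (carrier n)ᶜ = 0)
    (α : ℕ → ℝ≥0) (hα_pos : ∀ n, 0 < α n) (hα_sum : HasSum α 1)
    (F : Submodule ℝ (E →ₘ[MoscoSeq.mixture α ν] ℝ))
    (hF_sub : (F : Set (E →ₘ[MoscoSeq.mixture α ν] ℝ)) ⊆ MoscoSeq.classD α ν)
    (hF_dense : Dense (MoscoSeq.trace ν (F : Set (E →ₘ[MoscoSeq.mixture α ν] ℝ)) 0))
    (T : ∀ n, ContractionSemigroup (Lp ℝ 2 (ν n)))
    (hstable : MoscoSeq.ResolventStable F T)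
    (hconv : MoscoSeq.FormsConverge F T)
    (β : ℝ) (hβ : 0 < β) :
    (∀ (fs : ∀ k, Lp ℝ 2 (ν (k + 1))) (f : Lp ℝ 2 (ν 0)),
      MoscoSeq.WConv F (fun k => k + 1) fs f →
      MoscoSeq.WConv F (fun k => k + 1) (fun k => (T (k + 1)).resolvent β (fs k))
          ((T 0).resolvent β f) ∧
        MoscoSeq.WConv F (fun k => k + 1) (fun k => (T (k + 1)).dual.resolvent β (fs k))
          ((T 0).dual.resolvent β f)) ∧
    (∀ (gs : ∀ k, Lp ℝ 2 (ν (k + 1))) (g : Lp ℝ 2 (ν 0)),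
      MoscoSeq.SConv F (fun k => k + 1) gs g →
      MoscoSeq.SConv F (fun k => k + 1) (fun k => (T (k + 1)).resolvent β (gs k))
          ((T 0).resolvent β g) ∧
        MoscoSeq.SConv F (fun k => k + 1) (fun k => (T (k + 1)).dual.resolvent β (gs k))
          ((T 0).dual.resolvent β g)) := by
  have : Fact ((2 : ℝ≥0∞) ≠ ∞) := ⟨ENNReal.ofNat_ne_top⟩
  -- The countable base of `ν` makes `L²(E, ν)` separable, as weak compactness requires.
  have : SecondCountableTopology (Lp ℝ 2 (ν 0)) := Lp.SecondCountableTopology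
  have h := hconv.moscoConverge hα_pos hF_sub hF_dense carrier hcarrier_meas hcarrier_disj
    hcarrier hstable
  simp only [MoscoSeq.wConv_iff hα_pos hF_sub hF_dense carrier hcarrier_meas hcarrier_disj
    hcarrier HilbertSeq.isSubseq_succ, MoscoSeq.sConv_iff hα_pos hF_sub hF_dense carrier
    hcarrier_meas hcarrier_disj hcarrier HilbertSeq.isSubseq_succ]
  exact ⟨fun _ _ hf => ⟨h.weak_resolvent hβ hf, h.weak_dual_resolvent hβ hf⟩,
    fun _ _ hg => ⟨h.strong_resolvent hβ hg, h.strong_dual_resolvent hβ hg⟩⟩
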